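/- **Setting.** Let $H$ be a separable real Hilbert space, $p\in[2,\infty)$, $\mathcal P_p(H)$ the set of Borel probability measures $\mu$ on $H$ with $\|\mu\|_p=(\int|x|_H^p\,\mu(dx))^{1/p}<\infty$, and $W_p$ the Wasserstein distance $W_p(\mu,\nu)=\inf_\Gamma(\int|x-y|_H^p\,\Gamma(dx,dy))^{1/p}$ over couplings $\Gamma$ of $\mu,\nu$. Let $(\Omega,\mathcal F,\mathbb P,(\mathcal F_t)_{t\ge0})$ be a filtered probability space carrying an $\mathcal F_0$-measurable random variable uniform on $[0,1]$, and let $L^p_t(H)$ be the set of $\mathcal F_t$-measurable $X:\Omega\to H$ with $\|X\|_p=\mathbb E[|X|_H^p]^{1/p}<\infty$. Let $\Theta_{s,t}:\mathcal P_p(H)\to\mathcal P_p(H)$, $0\le s\le t$, with $\Theta_{t,t}=\mathrm{Id}$. *$\beta$-sewing property* (with constants $L_{sew},C_{sew}>0$): there are operators $\mathcal X_{s,r,t}=(\mathcal X^1_{s,r,t},\mathcal X^2_{s,r,t}):L^p_s(H)^2\to L^p_t(H)^2$, $s\le r\le t$, such that, with $\widehat{\mathcal E}^\ell(X)=\mathbb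 E[\mathcal X^\ell_{s,r,t}(X)-X^\ell\mid\mathcal F_s]$ and $\widetilde{\mathcal E}^\ell(X)=\mathcal X^\ell_{s,r,t}(X)-X^\ell-\widehat{\mathcal E}^\ell(X)$, for all $s\le r\le t$ and $X=(X^1,X^2)\in L^p_s(H)^2$: * if $X^1\sim\mu^1$ and $X^2\sim\mu^2$, then $\mathcal X^1_{s,r,t}(X)\sim\Theta_{s,t}(\mu^1)$ and $\mathcal X^2_{s,r,t}(X)\sim\Theta_{r,t}\circ\Theta_{s,r}(\mu^2)$; * $\|\widehat{\mathcal E}^1(X)\|_p\le L_{sew}(t-s)(1+\|X^1\|_p)$ and $\|\widetilde{\mathcal E}^1(X)\|_p\le L_{sew}(t-s)^{1/2}(1+\|X^1\|_p)$; * $\|\widehat{\mathcal E}^2(X)-\widehat{\mathcal E}^1(X)\|_p\le C_{sew}(t-s)\,D$ and $\|\widetilde{\mathcal E}^2(X)-\widetilde{\mathcal E}^1(X)\|_p\le C_{sew}(t-s)^{1/2}D$, where $D=\|X^1-X^2\|_p+(1+\|X^1\|_p+\|X^2\|_p)(t-s)^\beta$. *Property* $\mathbf C$: there is a nondecreasing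 $\varphi:[0,\infty)\to[0,\infty)$ with $\lim_{\delta\downarrow0}\varphi(\delta)=0$ and $W_p(\Theta_{s,t}(\mu),\mu)\le(1+\|\mu\|_p)\varphi(t-s)$ for all $0\le s<t$ and $\mu\in\mathcal P_p(H)$. For a partition $\pi=\{s=t_0<\dots<t_N=t\}$ of $[s,t]$ put $|\pi|=\max_i(t_i-t_{i-1})$ and $\Theta^\pi_{s,t}=\Theta_{t_{N-1},t_N}\circ\dots\circ\Theta_{t_0,t_1}$. Let $\Theta^n_{s,t}$ be the composition of the maps $\Theta_{k2^{-n},(k+1)2^{-n}}$, $\lfloor2^ns\rfloor\le k<\lfloor2^nt\rfloor$, in increasing order of $k$ (first applied $k=\lfloor 2^ns\rfloor$). A *limit flow* of $\Theta$ is a family $\theta_{s,t}:\mathcal P_p(H)\to\mathcal P_p(H)$, $0\le s\le t$, with $\theta_{s,t}=\theta_{r,t}\circ\theta_{s,r}$ for $s\le r\le t$ and $W_p(\Theta^n_{s,t}(\mu),\theta_{s,t}(\mu))\to0$ as $n\to\infty$ for all $s<t$ and $\mu\in\mathcal P_p(H)$. **Theorem 2.7 (speed of convergence).** Let $p\ge2$,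 $\beta>0$, $T>0$, $L_{sew}>0$, $C_{sew}>0$. There is a constant $C'_T\in\mathbb R_+$, depending only on $T,p,L_{sew},C_{sew},\beta$, such that in the above setting, whenever $\Theta$ has the $\beta$-sewing property with constants $L_{sew},C_{sew}$ and satisfies $\mathbf C$, a limit flow of $\Theta$ exists, and every limit flow $\theta$ of $\Theta$ satisfies, for all $0\le s<t\le T$, all $\mu\in\mathcal P_p(H)$ and every partition $\pi$ of $[s,t]$, $$W_p(\Theta^\pi_{s,t}(\mu),\theta_{s,t}(\mu))\le C'_T(1+\|\mu\|_p)(t-s)^{1/2}|\pi|^\beta .$$ In particular, $W_p(\Theta_{s,t}(\mu),\theta_{s,t}(\mu))\le C'_T(1+\|\mu\|_p)(t-s)^{1/2+\beta}$. -/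

import Mathlib

open MeasureTheory ProbabilityTheory Filter Topology
open scoped NNReal ENNReal

namespace WassersteinSewing

/-- The space `𝒫_p(H)` of Borel probability measures on `H` with finite moment of order `p`. -/
@[ext]
structure PSpace (p : ℝ≥0) (H : Type*) [NormedAddCommGroup H] [MeasurableSpace H] where
  /-- the underlying measure -/
  toMeasure : Measure H
  isProbabilityMeasure : IsProbabilityMeasure toMeasure
  memLp : MemLp (fun x : H => x) p toMeasure

section Spaces

variable {p : ℝ≥0} {H : Type*} [NormedAddCommGroup H] [MeasurableSpace H]

/-- `‖μ‖_p = (∫ |x|^p μ(dx))^{1/p}`, a finite element of `[0, ∞]`. -/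
noncomputable def PSpace.norm (μ : PSpace p H) : ℝ≥0∞ :=
  eLpNorm (fun x : H => x) p μ.toMeasure

/-- Couplings of two measures: measures on the product with the given marginals.
(When both marginals are in `𝒫_p(H)`, a coupling is automatically a probability measure with
finite moment of order `p`.) -/
def IsCoupling (μ ν : Measure H) (Γ : Measure (H × H)) : Prop :=
  Γ.map Prod.fst = μ ∧ Γ.map Prod.snd = ν

/-- The Wasserstein distance
`W_p(μ, ν) = inf_Γ (∫ |x - y|^p Γ(dx, dy))^{1/p}`, the infimum over all couplings `Γ`. -/
noncomputable def W (μ ν : PSpace p H) : ℝ≥0∞ :=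
  ⨅ (Γ : Measure (H × H)) (_ : IsCoupling μ.toMeasure ν.toMeasure Γ),
    eLpNorm (fun z : H × H => z.1 - z.2) p Γ

end Spaces

/-- A partition `s = t_0 < t_1 < ⋯ < t_N = t` of `[s, t]`; the values `pt i` with `i > N` play
no role. -/
structure Partition (s t : ℝ≥0) where
  /-- the number `N` of steps -/
  N : ℕ
  /-- the points `t_i` -/
  pt : ℕ → ℝ≥0
  pt_zero : pt 0 = s
  pt_last : pt N = t
  pt_lt : ∀ i < N, pt i < pt (i + 1)

/-- The mesh `|π| = max_{1 ≤ i ≤ N} (t_i - t_{i-1})`. -/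
noncomputable def Partition.mesh {s t : ℝ≥0} (π : Partition s t) : ℝ≥0 :=
  (Finset.range π.N).sup fun i => π.pt (i + 1) - π.pt i

section Schemes

variable {E : Type*}

/-- `compose Θ τ N = Θ_{τ(N-1),τ(N)} ∘ ⋯ ∘ Θ_{τ(0),τ(1)}`, the identity if `N = 0`. -/
def compose (Θ : ℝ≥0 → ℝ≥0 → E → E) (τ : ℕ → ℝ≥0) : ℕ → E → E
  | 0, μ => μ
  | k + 1, μ => Θ (τ k) (τ (k + 1)) (compose Θ τ k μ)

/-- The scheme `Θ^π_{s,t}` of a partition `π` of `[s, t]`. -/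
def scheme (Θ : ℝ≥0 → ℝ≥0 → E → E) {s t : ℝ≥0} (π : Partition s t) : E → E :=
  compose Θ π.pt π.N

/-- The dyadic scheme `Θ^n_{s,t}`: the composition over all steps of length `2^{-n}` from
`⌊2^n s⌋ / 2^n` to `⌊2^n t⌋ / 2^n`. -/
noncomputable def dyadicScheme (Θ : ℝ≥0 → ℝ≥0 → E → E) (n : ℕ) (s t : ℝ≥0) : E → E :=
  compose Θ (fun k => ((⌊2 ^ n * s⌋₊ + k : ℕ) : ℝ≥0) / 2 ^ n) (⌊2 ^ n * t⌋₊ - ⌊2 ^ n * s⌋₊)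

end Schemes

section Coupling

variable {H : Type*} [NormedAddCommGroup H] [MeasurableSpace H]
variable {Ω : Type*} {mΩ : MeasurableSpace Ω}

/-- The filtered space carries a uniform random variable on `[0,1]` that is
`ℱ_0`-measurable. -/
def Atomless (ℱ : Filtration ℝ≥0 mΩ) (P : Measure Ω) : Prop :=
  ∃ U : Ω → ℝ, Measurable[ℱ 0] U ∧ P.map U = volume.restrict (Set.Icc (0 : ℝ) 1)

/-- `L^p_t(H)`: the `ℱ_t`-measurable random variables `X : Ω → H` with `‖X‖_p < ∞`. -/
def LpAt (H : Type*) [NormedAddCommGroup H] [MeasurableSpace H]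
    (p : ℝ≥0) (ℱ : Filtration ℝ≥0 mΩ) (P : Measure Ω) (t : ℝ≥0) : Type _ :=
  {X : Ω → H // Measurable[ℱ t] X ∧ MemLp X p P}

/-- `Ê = 𝔼_{ℱ_s}(Y - X)`, the conditional expectation of an increment. -/
noncomputable def hatInc [NormedSpace ℝ H] [CompleteSpace H] (ℱ : Filtration ℝ≥0 mΩ)
    (P : Measure Ω) (s : ℝ≥0) (X Y : Ω → H) : Ω → H :=
  P[Y - X | ℱ s]

/-- `Ẽ = (Y - X) - Ê`, the martingale part of an increment. -/
noncomputable def tildeInc [NormedSpace ℝ H] [CompleteSpace H] (ℱ : Filtration ℝ≥0 mΩ)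
    (P : Measure Ω) (s : ℝ≥0) (X Y : Ω → H) : Ω → H :=
  (Y - X) - hatInc ℱ P s X Y

/-- `𝒳` is a `β`-coupling family of operators for `Θ` with constants `L` and `C`. Here
`(X.1.1, X.2.1)` is the input pair of random variables and `((𝒳 s r t X).1.1, (𝒳 s r t X).2.1)`
the output pair. Only times `s ≤ r ≤ t` matter. -/
structure IsCouplingFamily [NormedSpace ℝ H] [CompleteSpace H] {p : ℝ≥0}
    (ℱ : Filtration ℝ≥0 mΩ) (P : Measure Ω)
    (Θ : ℝ≥0 → ℝ≥0 → PSpace p H → PSpace p H) (β : ℝ) (L C : ℝ≥0)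
    (𝒳 : ∀ s _r t : ℝ≥0, LpAt H p ℱ P s × LpAt H p ℱ P s → LpAt H p ℱ P t × LpAt H p ℱ P t) :
    Prop where
  /-- Representation, first marginal. -/
  repr_one : ∀ s r t : ℝ≥0, s ≤ r → r ≤ t → ∀ (μ₁ μ₂ : PSpace p H)
    (X : LpAt H p ℱ P s × LpAt H p ℱ P s),
    P.map X.1.1 = μ₁.toMeasure → P.map X.2.1 = μ₂.toMeasure →
      P.map (𝒳 s r t X).1.1 = (Θ s t μ₁).toMeasure
  /-- Representation, second marginal. -/
  repr_two : ∀ s r t : ℝ≥0, s ≤ r → r ≤ t → ∀ (μ₁ μ₂ : PSpace p H)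
    (X : LpAt H p ℱ P s × LpAt H p ℱ P s),
    P.map X.1.1 = μ₁.toMeasure → P.map X.2.1 = μ₂.toMeasure →
      P.map (𝒳 s r t X).2.1 = (Θ r t (Θ s r μ₂)).toMeasure
  /-- Growth, finite variation part. -/
  growth_hat : ∀ s r t : ℝ≥0, s ≤ r → r ≤ t → ∀ X : LpAt H p ℱ P s × LpAt H p ℱ P s,
    eLpNorm (hatInc ℱ P s X.1.1 (𝒳 s r t X).1.1) p P ≤
      (L * (t - s) : ℝ≥0) * (1 + eLpNorm X.1.1 p P)
  /-- Growth, martingale part. -/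
  growth_tilde : ∀ s r t : ℝ≥0, s ≤ r → r ≤ t → ∀ X : LpAt H p ℱ P s × LpAt H p ℱ P s,
    eLpNorm (tildeInc ℱ P s X.1.1 (𝒳 s r t X).1.1) p P ≤
      (L * (t - s) ^ (1 / 2 : ℝ) : ℝ≥0) * (1 + eLpNorm X.1.1 p P)
  /-- Stochastic sewing, finite variation part. -/
  sewing_hat : ∀ s r t : ℝ≥0, s ≤ r → r ≤ t → ∀ X : LpAt H p ℱ P s × LpAt H p ℱ P s,
    eLpNorm (hatInc ℱ P s X.2.1 (𝒳 s r t X).2.1 - hatInc ℱ P s X.1.1 (𝒳 s r t X).1.1) p P ≤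
      (C * (t - s) : ℝ≥0) * (eLpNorm (X.1.1 - X.2.1) p P +
        (1 + (eLpNorm X.1.1 p P + eLpNorm X.2.1 p P)) * ((t - s) ^ β : ℝ≥0))
  /-- Stochastic sewing, martingale part. -/
  sewing_tilde : ∀ s r t : ℝ≥0, s ≤ r → r ≤ t → ∀ X : LpAt H p ℱ P s × LpAt H p ℱ P s,
    eLpNorm (tildeInc ℱ P s X.2.1 (𝒳 s r t X).2.1 -
        tildeInc ℱ P s X.1.1 (𝒳 s r t X).1.1) p P ≤
      (C * (t - s) ^ (1 / 2 : ℝ) : ℝ≥0) * (eLpNorm (X.1.1 - X.2.1) p P +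
        (1 + (eLpNorm X.1.1 p P + eLpNorm X.2.1 p P)) * ((t - s) ^ β : ℝ≥0))

/-- The `β`-sewing property of `Θ`, with constants `L` and `C`, on the given filtered
probability space. -/
def SewingProperty [NormedSpace ℝ H] [CompleteSpace H] {p : ℝ≥0}
    (ℱ : Filtration ℝ≥0 mΩ) (P : Measure Ω)
    (Θ : ℝ≥0 → ℝ≥0 → PSpace p H → PSpace p H) (β : ℝ) (L C : ℝ≥0) : Prop :=
  ∃ 𝒳, IsCouplingFamily ℱ P Θ β L C 𝒳

/-- The uniform continuity property on the diagonal. -/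
def ContinuityProperty {p : ℝ≥0} (Θ : ℝ≥0 → ℝ≥0 → PSpace p H → PSpace p H) : Prop :=
  ∃ φ : ℝ≥0 → ℝ≥0, Monotone φ ∧ Tendsto φ (𝓝[>] 0) (𝓝 0) ∧
    ∀ s t : ℝ≥0, s < t → ∀ μ : PSpace p H, W (Θ s t μ) μ ≤ (1 + μ.norm) * φ (t - s)

/-- `θ` is a flow, and it is the limit in `W_p` of the dyadic schemes of `Θ`. -/
structure IsLimitFlow {p : ℝ≥0} (Θ θ : ℝ≥0 → ℝ≥0 → PSpace p H → PSpace p H) : Prop where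
  flow : ∀ s r t : ℝ≥0, s ≤ r → r ≤ t → θ s t = θ r t ∘ θ s r
  tendsto : ∀ s t : ℝ≥0, s < t → ∀ μ : PSpace p H,
    Tendsto (fun n : ℕ => W (dyadicScheme Θ n s t μ) (θ s t μ)) atTop (𝓝 0)

end Coupling

end WassersteinSewing

open WassersteinSewing

universe u v

/-!
For `p ≥ 2` the space `L^p(H)` is 2-smooth: adding a martingale increment to a random variable
increases the square of its norm by at most a multiple of the square of the norm of the increment.
Applied to the difference of two coupled schemes, whose one-step increments are controlled by the
sewing operators, this gives a discrete Gronwall estimate: a scheme along a partition depends on its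
initial measure in a Lipschitz way, and inserting at most one point into each gap of a partition of
`[s, t]` of mesh `h` moves the final measure by at most a constant times `(t - s)^{1/2} h^β`. The
coupling of two measures is carried from step to step by the random variables themselves, and the
initial one is realised on `Ω` by means of the uniform random variable.

Halving a grid inserts one point into each gap, so the errors along the refinements of a uniform
grid form a geometric series of ratio `2^{-β}`. An arbitrary partition is compared with fine grids
by adding to it the points of a grid of about the same mesh and its successive halvings; on a
sufficiently fine grid the points of the partition can be removed again, as each gap contains at
most one of them. So the schemes along dyadic grids form a Cauchy sequence in the complete metric
space `(𝒫_p(H), W_p)`. Property `C` absorbs the rounding of `s` and `t` to dyadic numbers.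
-/

namespace WassersteinSewing

section Gluing

variable {E : Type*} [MeasurableSpace E]

lemma IsCoupling.isProbabilityMeasure {μ ν : Measure E}
    [IsProbabilityMeasure μ] {Γ : Measure (E × E)} (h : IsCoupling μ ν Γ) :
    IsProbabilityMeasure Γ := by
  constructor
  rw [← measure_univ (μ := μ), ← h.1, Measure.map_apply measurable_fst .univ, Set.preimage_univ]

lemma isCoupling_map {Ω : Type*} [MeasurableSpace Ω] {P : Measure Ω} {X Y : Ω → E}
    (hX : Measurable X) (hY : Measurable Y) :
    IsCoupling (P.map X) (P.map Y) (P.map fun ω => (X ω, Y ω)) :=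
  have hXY := hX.prodMk hY
  ⟨Measure.map_map measurable_fst hXY, Measure.map_map measurable_snd hXY⟩

lemma map_compProd_comap {F G : Type*} [MeasurableSpace F] [MeasurableSpace G] (μ : Measure F)
    [SFinite μ] (κ : Kernel E G) [IsSFiniteKernel κ] {f : F → E} (hf : Measurable f) :
    (μ ⊗ₘ κ.comap f hf).map (Prod.map f id) = μ.map f ⊗ₘ κ := by
  ext s hs
  rw [Measure.map_apply (by fun_prop) hs, Measure.compProd_apply (hs.preimage (by fun_prop)),
    Measure.compProd_apply hs, lintegral_map (Kernel.measurable_kernel_prodMk_left hs) hf]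
  rfl

lemma exists_map_prodMk_eq [StandardBorelSpace E] {μ ν ρ : Measure E} [IsProbabilityMeasure ν]
    [IsProbabilityMeasure μ] {Γ₁ Γ₂ : Measure (E × E)} (h₁ : IsCoupling μ ν Γ₁)
    (h₂ : IsCoupling ν ρ Γ₂) :
    ∃ Q : Measure ((E × E) × E), Q.map Prod.fst = Γ₁ ∧ Q.map (fun z => (z.1.2, z.2)) = Γ₂ := by
  have := h₁.isProbabilityMeasure
  have := h₂.isProbabilityMeasure
  have := nonempty_of_isProbabilityMeasure ν
  refine ⟨Γ₁ ⊗ₘ Γ₂.condKernel.comap Prod.snd measurable_snd, Measure.fst_compProd _ _, ?_⟩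
  refine (map_compProd_comap Γ₁ Γ₂.condKernel measurable_snd).trans ?_
  rw [h₁.2, ← h₂.1]
  exact Γ₂.disintegrate Γ₂.condKernel

/-- The law on path space of the inhomogeneous Markov chain with initial law `μ₀` and transition
kernels `k n` from time `n` to time `n + 1`. -/
noncomputable def markovChain (μ₀ : Measure E) (k : ℕ → Kernel E E)
    [∀ n, IsMarkovKernel (k n)] : Measure (ℕ → E) :=
  Kernel.trajMeasure (X := fun _ => E) μ₀
    fun n => (k n).comap (fun x => x ⟨n, Finset.mem_Iic.2 le_rfl⟩) (by fun_prop)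

instance (μ₀ : Measure E) [IsProbabilityMeasure μ₀] (k : ℕ → Kernel E E)
    [∀ n, IsMarkovKernel (k n)] : IsProbabilityMeasure (markovChain μ₀ k) := by
  rw [markovChain]
  infer_instance

lemma markovChain_map_eval_zero (μ₀ : Measure E) [IsProbabilityMeasure μ₀] (k : ℕ → Kernel E E)
    [∀ n, IsMarkovKernel (k n)] : (markovChain μ₀ k).map (fun x => x 0) = μ₀ := by
  have map_restrict : (markovChain μ₀ k).map (Preorder.frestrictLe (π := fun _ => E) 0) =
      μ₀.map (MeasurableEquiv.piUnique (fun _ : Finset.Iic 0 => E)).symm := by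
    rw [markovChain, Kernel.trajMeasure, Measure.map_comp _ _ (by fun_prop),
      Kernel.traj_map_frestrictLe, Kernel.partialTraj_self, Measure.id_comp]
  calc (markovChain μ₀ k).map (fun x => x 0)
      = ((markovChain μ₀ k).map (Preorder.frestrictLe (π := fun _ => E) 0)).map
          fun z => z ⟨0, Finset.mem_Iic.2 le_rfl⟩ := by
        rw [Measure.map_map (by fun_prop) (by fun_prop)]
        rfl
    _ = μ₀ := by
        rw [map_restrict, Measure.map_map (by fun_prop) (by fun_prop)]
        exact Measure.map_id

lemma markovChain_map_eval_succ (μ₀ : Measure E) [IsProbabilityMeasure μ₀] (k : ℕ → Kernel E E)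
    [∀ n, IsMarkovKernel (k n)] (n : ℕ) :
    (markovChain μ₀ k).map (fun x => (x n, x (n + 1))) =
      (markovChain μ₀ k).map (fun x => x n) ⊗ₘ k n := by
  let last (z : Π _ : Finset.Iic n, E) : E := z ⟨n, Finset.mem_Iic.2 le_rfl⟩
  have last_measurable : Measurable last := by fun_prop
  calc (markovChain μ₀ k).map (fun x => (x n, x (n + 1)))
      = (((markovChain μ₀ k).map (Preorder.frestrictLe n)) ⊗ₘ
          (k n).comap last last_measurable).map (Prod.map last id) := by
        rw [markovChain, Kernel.map_frestrictLe_trajMeasure_compProd_eq_map_trajMeasure,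
          Measure.map_map (by fun_prop) (by fun_prop)]
        rfl
    _ = (markovChain μ₀ k).map (fun x => x n) ⊗ₘ k n := by
        rw [map_compProd_comap, Measure.map_map last_measurable (by fun_prop)]
        rfl

lemma exists_forall_map_prodMk_eq [StandardBorelSpace E] (m : ℕ → Measure E)
    [∀ n, IsProbabilityMeasure (m n)] (Γ : ℕ → Measure (E × E))
    (hΓ : ∀ n, IsCoupling (m n) (m (n + 1)) (Γ n)) :
    ∃ Q : Measure (ℕ → E), IsProbabilityMeasure Q ∧
      ∀ n, Q.map (fun x => (x n, x (n + 1))) = Γ n := by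
  have Γ_prob (n : ℕ) : IsProbabilityMeasure (Γ n) := (hΓ n).isProbabilityMeasure
  have := nonempty_of_isProbabilityMeasure (m 0)
  let Q := markovChain (m 0) fun n => (Γ n).condKernel
  have map_pair (n : ℕ) (hn : Q.map (fun x => x n) = m n) :
      Q.map (fun x => (x n, x (n + 1))) = Γ n := by
    rw [markovChain_map_eval_succ, hn, ← (hΓ n).1]
    exact (Γ n).disintegrate (Γ n).condKernel
  have map_eval (n : ℕ) : Q.map (fun x => x n) = m n := by
    induction n with
    | zero => exact markovChain_map_eval_zero _ _
    | succ n ih =>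
      rw [← (hΓ n).2, ← map_pair n ih, Measure.map_map measurable_snd (by fun_prop)]
      rfl
  exact ⟨Q, inferInstance, fun n => map_pair n (map_eval n)⟩

end Gluing

section Wasserstein

variable {p : ℝ≥0} {H : Type*} [NormedAddCommGroup H] [MeasurableSpace H]

instance PSpace.instIsProbabilityMeasure (μ : PSpace p H) : IsProbabilityMeasure μ.toMeasure :=
  μ.isProbabilityMeasure

lemma PSpace.norm_ne_top (μ : PSpace p H) : μ.norm ≠ ∞ := μ.memLp.eLpNorm_ne_top

lemma exists_isCoupling_eLpNorm_lt {μ ν : PSpace p H} {c : ℝ≥0∞} (h : W μ ν < c) :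
    ∃ Γ, IsCoupling μ.toMeasure ν.toMeasure Γ ∧
      eLpNorm (fun z : H × H => z.1 - z.2) p Γ < c := by
  simpa only [W, iInf_lt_iff, exists_prop] using h

lemma memLp_of_map_eq {Ω : Type*} [MeasurableSpace Ω] {P : Measure Ω} {X : Ω → H}
    (hX : Measurable X) {μ : PSpace p H} (h : P.map X = μ.toMeasure) : MemLp X p P :=
  (h ▸ μ.memLp).comp_of_map hX.aemeasurable

variable [BorelSpace H] [SecondCountableTopology H]

lemma eLpNorm_eq_of_map_eq {Ω : Type*} [MeasurableSpace Ω] {P : Measure Ω} {X : Ω → H}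
    (hX : Measurable X) {μ : PSpace p H} (h : P.map X = μ.toMeasure) :
    eLpNorm X p P = μ.norm := by
  rw [PSpace.norm, ← h, eLpNorm_map_measure (by fun_prop) hX.aemeasurable, Function.comp_def]

lemma W_le_of_map {Ω : Type*} [MeasurableSpace Ω] {P : Measure Ω} {X Y : Ω → H}
    (hX : Measurable X) (hY : Measurable Y) {μ ν : PSpace p H}
    (h₁ : P.map X = μ.toMeasure) (h₂ : P.map Y = ν.toMeasure) :
    W μ ν ≤ eLpNorm (X - Y) p P := by
  refine iInf₂_le_of_le (P.map fun ω => (X ω, Y ω)) (h₁ ▸ h₂ ▸ isCoupling_map hX hY) ?_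
  rw [eLpNorm_map_measure (by fun_prop) (by fun_prop)]
  rfl

lemma W_self (μ : PSpace p H) : W μ μ = 0 := by
  simpa using W_le_of_map (P := μ.toMeasure) measurable_id measurable_id Measure.map_id
    Measure.map_id

lemma W_comm (μ ν : PSpace p H) : W μ ν = W ν μ := by
  have W_le (μ ν : PSpace p H) : W μ ν ≤ W ν μ := le_iInf₂ fun Γ hΓ =>
    (W_le_of_map measurable_snd measurable_fst hΓ.2 hΓ.1).trans (eLpNorm_sub_comm _ _ _ _).le
  exact le_antisymm (W_le _ _) (W_le _ _)

lemma lintegral_le_lintegral_add_mul_W (hp : 1 ≤ p) {f : H → ℝ≥0} {K : ℝ≥0} (hK : K ≠ 0)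
    (hf : LipschitzWith K f) (μ ν : PSpace p H) :
    ∫⁻ x, f x ∂μ.toMeasure ≤ ∫⁻ x, f x ∂ν.toMeasure + K * W μ ν := by
  have hfm : Measurable f := hf.continuous.measurable
  simp only [W, ENNReal.mul_iInf_of_ne (ENNReal.coe_ne_zero.2 hK) ENNReal.coe_ne_top,
    ENNReal.add_iInf]
  refine le_iInf₂ fun Γ hΓ => ?_
  have := hΓ.isProbabilityMeasure
  calc ∫⁻ x, f x ∂μ.toMeasure
      = ∫⁻ z, f z.1 ∂Γ := by rw [← hΓ.1, lintegral_map (by fun_prop) measurable_fst]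
    _ ≤ ∫⁻ z, f z.2 + K * ‖z.1 - z.2‖ₑ ∂Γ := by
        refine lintegral_mono fun z => ?_
        have hLip : f z.1 ≤ f z.2 + K * ‖z.1 - z.2‖₊ := by
          rw [← nndist_eq_nnnorm_sub, ← tsub_le_iff_left]
          exact (le_max_left _ _).trans
            ((NNReal.nndist_eq _ _).symm.trans_le (hf.nndist_le z.1 z.2))
        exact ENNReal.coe_le_coe.2 hLip
    _ = ∫⁻ x, f x ∂ν.toMeasure + K * eLpNorm (fun z : H × H => z.1 - z.2) 1 Γ := by
        rw [lintegral_add_left (by fun_prop), lintegral_const_mul _ (by fun_prop), ← hΓ.2,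
          lintegral_map (by fun_prop) measurable_snd, eLpNorm_one_eq_lintegral_enorm]
    _ ≤ ∫⁻ x, f x ∂ν.toMeasure + K * eLpNorm (fun z : H × H => z.1 - z.2) p Γ := by
        gcongr
        exact eLpNorm_le_eLpNorm_of_exponent_le (by exact_mod_cast hp) (by fun_prop)

lemma eq_of_W_eq_zero (hp : 1 ≤ p) {μ ν : PSpace p H} (h : W μ ν = 0) : μ = ν := by
  have lintegral_eq {f : H → ℝ≥0} {K : ℝ≥0} (hK : K ≠ 0) (hf : LipschitzWith K f) :
      ∫⁻ x, f x ∂μ.toMeasure = ∫⁻ x, f x ∂ν.toMeasure := by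
    refine le_antisymm ?_ ?_
    · simpa [h] using lintegral_le_lintegral_add_mul_W hp hK hf μ ν
    · simpa [W_comm ν μ, h] using lintegral_le_lintegral_add_mul_W hp hK hf ν μ
  refine PSpace.ext (ext_of_generate_finite _
    (BorelSpace.measurable_eq.trans borel_eq_generateFrom_isClosed) isPiSystem_isClosed
    (fun F hF => ?_) (by simp only [measure_univ]))
  have δ_pos (n : ℕ) : 0 < 1 / ((n : ℝ) + 1) := Nat.one_div_pos_of_nat
  have δ_lim := tendsto_one_div_add_atTop_nhds_zero_nat (𝕜 := ℝ)
  refine tendsto_nhds_unique (tendsto_lintegral_thickenedIndicator_of_isClosed μ.toMeasure hF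
    δ_pos δ_lim) ((tendsto_lintegral_thickenedIndicator_of_isClosed ν.toMeasure hF
    δ_pos δ_lim).congr fun n =>
      (lintegral_eq ?_ (lipschitzWith_thickenedIndicator (δ_pos n) F)).symm)
  simp only [ne_eq, inv_eq_zero, Real.toNNReal_eq_zero, not_le, δ_pos]

variable [CompleteSpace H]

lemma exists_forall_map_eq (μ : ℕ → PSpace p H) (Γ : ℕ → Measure (H × H))
    (hΓ : ∀ n, IsCoupling (μ n).toMeasure (μ (n + 1)).toMeasure (Γ n)) :
    ∃ Q : Measure (ℕ → H), IsProbabilityMeasure Q ∧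
      (∀ n, Q.map (fun x => x n) = (μ n).toMeasure) ∧
      ∀ n, eLpNorm (fun x => x n - x (n + 1)) p Q = eLpNorm (fun z => z.1 - z.2) p (Γ n) := by
  obtain ⟨Q, hQ, hQΓ⟩ := exists_forall_map_prodMk_eq (fun n => (μ n).toMeasure) Γ hΓ
  refine ⟨Q, hQ, fun n => ?_, fun n => ?_⟩
  · rw [← (hΓ n).1, ← hQΓ n, Measure.map_map (by fun_prop) (by fun_prop), Function.comp_def]
  · rw [← hQΓ n, eLpNorm_map_measure (by fun_prop) (by fun_prop), Function.comp_def]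

lemma W_triangle (hp : 1 ≤ p) (μ ν ρ : PSpace p H) : W μ ρ ≤ W μ ν + W ν ρ := by
  conv_rhs => rw [W, W]
  simp_rw [ENNReal.iInf_add, ENNReal.add_iInf]
  refine le_iInf₂ fun Γ₁ h₁ => le_iInf₂ fun Γ₂ h₂ => ?_
  obtain ⟨Q, hQ₁, hQ₂⟩ := exists_map_prodMk_eq h₁ h₂
  have law₁ : Q.map (fun z => z.1.1) = μ.toMeasure := by
    rw [← h₁.1, ← hQ₁, Measure.map_map measurable_fst measurable_fst, Function.comp_def]
  have law₂ : Q.map Prod.snd = ρ.toMeasure := by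
    rw [← h₂.2, ← hQ₂, Measure.map_map measurable_snd (by fun_prop), Function.comp_def]
  have dist₁ : eLpNorm (fun z : (H × H) × H => z.1.1 - z.1.2) p Q =
      eLpNorm (fun z : H × H => z.1 - z.2) p Γ₁ := by
    rw [← hQ₁, eLpNorm_map_measure (by fun_prop) (by fun_prop), Function.comp_def]
  have dist₂ : eLpNorm (fun z : (H × H) × H => z.1.2 - z.2) p Q =
      eLpNorm (fun z : H × H => z.1 - z.2) p Γ₂ := by
    rw [← hQ₂, eLpNorm_map_measure (by fun_prop) (by fun_prop), Function.comp_def]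
  rw [← dist₁, ← dist₂]
  refine (W_le_of_map (by fun_prop) measurable_snd law₁ law₂).trans (le_trans (le_of_eq ?_)
    (eLpNorm_add_le (by fun_prop) (by fun_prop) (by exact_mod_cast hp)))
  exact congrArg (eLpNorm · p Q) (funext fun z => (sub_add_sub_cancel z.1.1 z.1.2 z.2).symm)

variable [Fact (1 ≤ p)]

noncomputable instance PSpace.instEMetricSpace : EMetricSpace (PSpace p H) where
  edist := W
  edist_self := W_self
  edist_comm := W_comm
  edist_triangle := W_triangle Fact.out
  eq_of_edist_eq_zero := eq_of_W_eq_zero Fact.out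

lemma edist_eq_W (μ ν : PSpace p H) : edist μ ν = W μ ν := rfl

instance PSpace.instCompleteSpace : CompleteSpace (PSpace p H) := by
  refine EMetric.complete_of_convergent_controlled_sequences (fun n => 2⁻¹ ^ n)
    (fun n => ENNReal.pow_pos (by simp) n) fun μ hμ => ?_
  choose Γ hΓ hΓ_lt using fun n =>
    exists_isCoupling_eLpNorm_lt (hμ n n (n + 1) le_rfl n.le_succ)
  obtain ⟨Q, hQ, law, dist⟩ := exists_forall_map_eq μ Γ hΓ
  have mem (n : ℕ) : MemLp (fun x : ℕ → H => x n) p Q := memLp_of_map_eq (by fun_prop) (law n)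
  have : Fact (1 ≤ (p : ℝ≥0∞)) := ⟨by exact_mod_cast (Fact.out : 1 ≤ p)⟩
  have cauchy : CauchySeq fun n => (mem n).toLp := by
    refine cauchySeq_of_edist_le_of_tsum_ne_top (fun n => 2⁻¹ ^ n) (fun n => ?_)
      (by simp [ENNReal.tsum_geometric])
    rw [Lp.edist_toLp_toLp]
    exact (dist n).trans_le (hΓ_lt n).le
  obtain ⟨f, hf⟩ := cauchySeq_tendsto_of_complete cauchy
  have hfm : Measurable f := (Lp.stronglyMeasurable f).measurable
  let ν : PSpace p H := ⟨Q.map f, Measure.isProbabilityMeasure_map hfm.aemeasurable,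
    (memLp_map_measure_iff (by fun_prop) hfm.aemeasurable).2 (Lp.memLp f)⟩
  refine ⟨ν, tendsto_iff_edist_tendsto_0.2 (tendsto_of_tendsto_of_tendsto_of_le_of_le
    tendsto_const_nhds (tendsto_iff_edist_tendsto_0.1 hf) (fun _ => zero_le) fun n => ?_)⟩
  refine (W_le_of_map (by fun_prop) hfm (law n) rfl).trans_eq ?_
  rw [← Lp.edist_toLp_toLp _ _ (mem n) (Lp.memLp f), Lp.toLp_coeFn]

end Wasserstein

lemma Atomless.exists_measurable_map_eq {E Ω : Type*} [MeasurableSpace E] [StandardBorelSpace E]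
    {mΩ : MeasurableSpace Ω} {ℱ : Filtration ℝ≥0 mΩ} {P : Measure Ω} (hA : Atomless ℱ P)
    (μ : Measure E) [IsProbabilityMeasure μ] :
    ∃ X : Ω → E, Measurable[ℱ 0] X ∧ P.map X = μ := by
  obtain ⟨U, hU, U_law⟩ := hA
  have := nonempty_of_isProbabilityMeasure μ
  obtain ⟨f, hf, f_law⟩ := Measure.exists_measurable_map_eq μ
  let g : ℝ → E := f ∘ Set.projIcc 0 1 zero_le_one
  have hg : Measurable g := hf.comp continuous_projIcc.measurable
  refine ⟨g ∘ U, hg.comp hU, ?_⟩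
  rw [← Measure.map_map hg (hU.mono (ℱ.le 0) le_rfl), U_law,
    ← (measurePreserving_subtype_coe measurableSet_Icc).map_eq,
    Measure.map_map hg measurable_subtype_coe, ← f_law]
  congr 1
  ext x
  simp only [g, Function.comp_apply, Set.projIcc_val]

section Smoothness

lemma rpow_sub_rpow_le {q u v : ℝ} (hq : 1 ≤ q) (hu : 0 ≤ u) (hv : 0 ≤ v) :
    u ^ q - v ^ q ≤ q * u ^ (q - 1) * (u - v) := by
  rcases hu.eq_or_lt with rfl | hu
  · rcases hq.eq_or_lt with rfl | hq
    · simp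
    · rw [Real.zero_rpow (by linarith), Real.zero_rpow (by linarith)]
      simpa using Real.rpow_nonneg hv q
  · have bernoulli : 1 + q * (v / u - 1) ≤ v ^ q / u ^ q := by
      have h := one_add_mul_self_le_rpow_one_add (s := v / u - 1)
        (by linarith [div_nonneg hv hu.le]) hq
      rwa [add_sub_cancel, Real.div_rpow hv hu.le] at h
    rw [le_div_iff₀ (by positivity)] at bernoulli
    have hpow : u ^ q = u ^ (q - 1) * u := by
      rw [← Real.rpow_add_one hu.ne', sub_add_cancel]
    have hdiv : v / u * u ^ q = v * u ^ (q - 1) := by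
      rw [hpow]
      field_simp
    linear_combination bernoulli - q * hdiv + q * hpow

lemma rpow_sub_rpow_mul_sq_sub_sq_le {m r a : ℝ} (hm : 0 ≤ m) (hr : 0 ≤ r) (ha : 0 ≤ a) :
    (r ^ m - a ^ m) * (r ^ 2 - a ^ 2) ≤ 2 * (m + 1) * (r ^ m + a ^ m) * (r - a) ^ 2 := by
  wlog har : a ≤ r generalizing r a
  · linear_combination this ha hr (le_of_not_ge har)
  have hpow (c : ℝ) (hc : 0 ≤ c) : c ^ (m + 1) = c ^ m * c :=
    Real.rpow_add_one' hc (by linarith)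
  have tangent : r ^ m * r - a ^ m * a ≤ (m + 1) * r ^ m * (r - a) := by
    have h := rpow_sub_rpow_le (q := m + 1) (by linarith) hr ha
    rwa [add_sub_cancel_right, hpow r hr, hpow a ha] at h
  have symmetrize : (r ^ m - a ^ m) * (r + a) ≤ 2 * (r ^ m * r - a ^ m * a) := by
    have : 0 ≤ (r ^ m + a ^ m) * (r - a) := mul_nonneg (by positivity) (by linarith)
    linarith
  calc (r ^ m - a ^ m) * (r ^ 2 - a ^ 2) = (r ^ m - a ^ m) * (r + a) * (r - a) := by ring
    _ ≤ 2 * ((m + 1) * (r ^ m + a ^ m) * (r - a)) * (r - a) := by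
        refine mul_le_mul_of_nonneg_right ?_ (by linarith)
        have : 0 ≤ (m + 1) * a ^ m * (r - a) := mul_nonneg (by positivity) (by linarith)
        linarith
    _ = _ := by ring

lemma max_rpow_le_add {m a b : ℝ} (ha : 0 ≤ a) (hb : 0 ≤ b) : max a b ^ m ≤ a ^ m + b ^ m := by
  have := Real.rpow_nonneg ha m
  have := Real.rpow_nonneg hb m
  rcases max_choice a b with h | h <;> rw [h] <;> linarith

lemma add_rpow_le_two_rpow_mul {m a b : ℝ} (hm : 0 ≤ m) (ha : 0 ≤ a) (hb : 0 ≤ b) :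
    (a + b) ^ m ≤ 2 ^ m * (a ^ m + b ^ m) :=
  calc (a + b) ^ m ≤ (2 * max a b) ^ m := by
        gcongr
        linarith [le_max_left a b, le_max_right a b]
    _ = 2 ^ m * max a b ^ m := Real.mul_rpow zero_le_two (le_max_of_le_left ha)
    _ ≤ 2 ^ m * (a ^ m + b ^ m) := by
        gcongr
        exact max_rpow_le_add ha hb

lemma sq_rpow_half {p c : ℝ} (hc : 0 ≤ c) : (c ^ 2) ^ (p / 2) = c ^ p := by
  rw [← Real.rpow_natCast_mul hc, Nat.cast_two, mul_div_cancel₀ _ two_ne_zero]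

lemma sq_rpow_half_sub_one {p c : ℝ} (hc : 0 ≤ c) : (c ^ 2) ^ (p / 2 - 1) = c ^ (p - 2) := by
  rw [← sq_rpow_half hc, sub_div, div_self two_ne_zero]

lemma rpow_sub_two_mul_sq {p c : ℝ} (hp : 2 ≤ p) (hc : 0 ≤ c) : c ^ (p - 2) * c ^ 2 = c ^ p := by
  rw [← Real.rpow_two, ← Real.rpow_add' hc (by linarith), sub_add_cancel]

lemma rpow_sub_two_mul_sq_le_add {p a b : ℝ} (hp : 2 ≤ p) (ha : 0 ≤ a) (hb : 0 ≤ b) :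
    a ^ (p - 2) * b ^ 2 ≤ a ^ p + b ^ p := by
  have : 0 ≤ p - 2 := by linarith
  calc a ^ (p - 2) * b ^ 2 ≤ max a b ^ (p - 2) * max a b ^ 2 := by
        gcongr
        · exact le_max_left a b
        · exact le_max_right a b
    _ = max a b ^ p := rpow_sub_two_mul_sq hp (le_max_of_le_left ha)
    _ ≤ a ^ p + b ^ p := max_rpow_le_add ha hb

lemma rpow_sub_rpow_mul_sq_sub_sq_le_of_abs_sub_le {p r a b : ℝ} (hp : 2 ≤ p) (hr : 0 ≤ r)
    (ha : 0 ≤ a) (h : |r - a| ≤ b) :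
    (r ^ (p - 2) - a ^ (p - 2)) * (r ^ 2 - a ^ 2) ≤
      (p - 1) * 2 ^ p * (a ^ (p - 2) * b ^ 2 + b ^ p) := by
  have hb : 0 ≤ b := (abs_nonneg _).trans h
  have hm : 0 ≤ p - 2 := by linarith
  have sq_le : (r - a) ^ 2 ≤ b ^ 2 := sq_le_sq' (abs_le.1 h).1 (abs_le.1 h).2
  have pow_le : r ^ (p - 2) ≤ 2 ^ (p - 2) * (a ^ (p - 2) + b ^ (p - 2)) :=
    (Real.rpow_le_rpow hr (by linarith [le_abs_self (r - a)]) hm).trans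
      (add_rpow_le_two_rpow_mul hm ha hb)
  have le_pow : a ^ (p - 2) ≤ 2 ^ (p - 2) * (a ^ (p - 2) + b ^ (p - 2)) :=
    (le_add_of_nonneg_right (by positivity)).trans
      (le_mul_of_one_le_left (by positivity) (Real.one_le_rpow one_le_two hm))
  calc (r ^ (p - 2) - a ^ (p - 2)) * (r ^ 2 - a ^ 2)
      ≤ 2 * (p - 2 + 1) * (r ^ (p - 2) + a ^ (p - 2)) * (r - a) ^ 2 :=
        rpow_sub_rpow_mul_sq_sub_sq_le hm hr ha
    _ ≤ 2 * (p - 2 + 1) * (2 ^ (p - 2) * (a ^ (p - 2) + b ^ (p - 2)) +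
          2 ^ (p - 2) * (a ^ (p - 2) + b ^ (p - 2))) * b ^ 2 := by
        gcongr
    _ = (p - 1) * (2 ^ (p - 2) * 2 ^ 2) * (a ^ (p - 2) * b ^ 2 + b ^ (p - 2) * b ^ 2) := by ring
    _ = (p - 1) * 2 ^ p * (a ^ (p - 2) * b ^ 2 + b ^ p) := by
        rw [rpow_sub_two_mul_sq hp zero_le_two, rpow_sub_two_mul_sq hp hb]

lemma norm_add_rpow_le {H : Type*} [NormedAddCommGroup H] [InnerProductSpace ℝ H] {p : ℝ}
    (hp : 2 ≤ p) (x y : H) :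
    ‖x + y‖ ^ p ≤ ‖x‖ ^ p + p * (‖x‖ ^ (p - 2) * inner ℝ x y) +
      p ^ 2 * 2 ^ p / 2 * (‖x‖ ^ (p - 2) * ‖y‖ ^ 2 + ‖y‖ ^ p) := by
  have expand : ‖x + y‖ ^ 2 - ‖x‖ ^ 2 = 2 * inner ℝ x y + ‖y‖ ^ 2 := by
    linarith [norm_add_sq_real x y]
  have tangent : ‖x + y‖ ^ p - ‖x‖ ^ p ≤
      p / 2 * ‖x + y‖ ^ (p - 2) * (‖x + y‖ ^ 2 - ‖x‖ ^ 2) := by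
    have h := rpow_sub_rpow_le (q := p / 2) (by linarith) (sq_nonneg ‖x + y‖) (sq_nonneg ‖x‖)
    rwa [sq_rpow_half (norm_nonneg _), sq_rpow_half (norm_nonneg _),
      sq_rpow_half_sub_one (norm_nonneg _)] at h
  have second_order : (‖x + y‖ ^ (p - 2) - ‖x‖ ^ (p - 2)) * (‖x + y‖ ^ 2 - ‖x‖ ^ 2) ≤
      (p - 1) * 2 ^ p * (‖x‖ ^ (p - 2) * ‖y‖ ^ 2 + ‖y‖ ^ p) := by
    refine rpow_sub_rpow_mul_sq_sub_sq_le_of_abs_sub_le hp (norm_nonneg _) (norm_nonneg _) ?_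
    simpa using abs_norm_sub_norm_le (x + y) x
  have const_le :
      ‖x‖ ^ (p - 2) * ‖y‖ ^ 2 ≤ 2 ^ p * (‖x‖ ^ (p - 2) * ‖y‖ ^ 2 + ‖y‖ ^ p) :=
    (le_add_of_nonneg_right (by positivity)).trans
      (le_mul_of_one_le_left (by positivity) (Real.one_le_rpow one_le_two (by linarith)))
  linear_combination tangent + p / 2 * second_order + p / 2 * ‖x‖ ^ (p - 2) * expand +
    p / 2 * const_le

lemma rpow_add_mul_le_rpow {p K a b : ℝ} (hp : 2 ≤ p) (hK : 0 ≤ K) (ha : 0 ≤ a) (hb : 0 ≤ b) :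
    a ^ p + K * (a ^ (p - 2) * b ^ 2 + b ^ p) ≤ (a ^ 2 + (2 * K + 1) * b ^ 2) ^ (p / 2) := by
  have hp2 : 1 ≤ p / 2 := by linarith
  have hc : 1 ≤ 2 * K + 1 := by linarith
  have hbp : 0 ≤ b ^ p := by positivity
  have hab : 0 ≤ a ^ (p - 2) * b ^ 2 := by positivity
  have superadditive :
      a ^ p + (2 * K + 1) * b ^ p ≤ (a ^ 2 + (2 * K + 1) * b ^ 2) ^ (p / 2) := by
    have h := Real.add_rpow_le_rpow_add (sq_nonneg a)
      (show 0 ≤ (2 * K + 1) * b ^ 2 by positivity) hp2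
    rw [sq_rpow_half ha, Real.mul_rpow (by positivity) (by positivity), sq_rpow_half hb] at h
    linarith [mul_le_mul_of_nonneg_right (Real.self_le_rpow_of_one_le hc hp2) hbp]
  have tangent : a ^ p + (2 * K + 1) * (a ^ (p - 2) * b ^ 2) ≤
      (a ^ 2 + (2 * K + 1) * b ^ 2) ^ (p / 2) := by
    have h := rpow_sub_rpow_le hp2 (sq_nonneg a)
      (show 0 ≤ a ^ 2 + (2 * K + 1) * b ^ 2 by positivity)
    rw [sq_rpow_half ha, sq_rpow_half_sub_one ha] at h
    have : (2 * K + 1) * (a ^ (p - 2) * b ^ 2) ≤ p / 2 * ((2 * K + 1) * (a ^ (p - 2) * b ^ 2)) :=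
      le_mul_of_one_le_left (by positivity) hp2
    linear_combination h + this
  linarith

end Smoothness

section Martingale

variable {H : Type*} [NormedAddCommGroup H] {Ω : Type*} {mΩ : MeasurableSpace Ω} {P : Measure Ω}
  {p : ℝ≥0} {X Y : Ω → H}

lemma integrable_norm_rpow (hp : 2 ≤ p) (hX : MemLp X p P) :
    Integrable (fun ω => ‖X ω‖ ^ (p : ℝ)) P :=
  hX.integrable_norm_rpow (by simpa using (zero_lt_two.trans_le hp).ne') ENNReal.coe_ne_top

lemma integral_norm_rpow (hp : 2 ≤ p) (hX : MemLp X p P) :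
    ∫ ω, ‖X ω‖ ^ (p : ℝ) ∂P = (eLpNorm X p P).toReal ^ (p : ℝ) := by
  have hp0 : p ≠ 0 := (zero_lt_two.trans_le hp).ne'
  have h0 : 0 ≤ ∫ ω, ‖X ω‖ ^ (p : ℝ) ∂P := integral_nonneg fun _ => by positivity
  rw [hX.eLpNorm_eq_integral_rpow_norm (by simpa using hp0) ENNReal.coe_ne_top,
    ENNReal.coe_toReal, ENNReal.toReal_ofReal (by positivity),
    Real.rpow_inv_rpow h0 (by exact_mod_cast hp0)]

lemma integrable_norm_rpow_sub_two_mul_sq (hp : 2 ≤ p) (hX : MemLp X p P) (hY : MemLp Y p P) :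
    Integrable (fun ω => ‖X ω‖ ^ ((p : ℝ) - 2) * ‖Y ω‖ ^ 2) P := by
  refine ((integrable_norm_rpow hp hX).add (integrable_norm_rpow hp hY)).mono' ?_ ?_
  · exact (hX.1.norm.aemeasurable.pow_const _).aestronglyMeasurable.mul (hY.1.norm.pow 2)
  · refine ae_of_all _ fun ω => ?_
    rw [Real.norm_of_nonneg (by positivity)]
    exact rpow_sub_two_mul_sq_le_add (by exact_mod_cast hp) (norm_nonneg _) (norm_nonneg _)

lemma integral_norm_rpow_sub_two_mul_sq_le (hp : 2 ≤ p) (hX : MemLp X p P) (hY : MemLp Y p P) :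
    ∫ ω, ‖X ω‖ ^ ((p : ℝ) - 2) * ‖Y ω‖ ^ 2 ∂P ≤
      (eLpNorm X p P).toReal ^ ((p : ℝ) - 2) * (eLpNorm Y p P).toReal ^ 2 := by
  have hp2 : (0 : ℝ) ≤ p - 2 := sub_nonneg.2 (by exact_mod_cast hp)
  have hp0 : p ≠ 0 := (zero_lt_two.trans_le hp).ne'
  have hpr : (p : ℝ) ≠ 0 := by exact_mod_cast hp0
  have hpe : (p : ℝ≥0∞) ≠ 0 := by exact_mod_cast hp0
  have holder : ∫⁻ ω, ‖X ω‖ₑ ^ ((p : ℝ) - 2) * ‖Y ω‖ₑ ^ (2 : ℝ) ∂P ≤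
      eLpNorm X p P ^ ((p : ℝ) - 2) * eLpNorm Y p P ^ (2 : ℝ) := by
    have h := ENNReal.lintegral_mul_norm_pow_le (μ := P) (p := ((p : ℝ) - 2) / p) (q := 2 / p)
      (hX.1.enorm.pow_const (p : ℝ)) (hY.1.enorm.pow_const (p : ℝ))
      (by positivity) (by positivity) (by field_simp; ring)
    simp only [← ENNReal.rpow_mul, mul_div_cancel₀ _ hpr] at h
    rwa [eLpNorm_eq_lintegral_rpow_enorm_toReal hpe ENNReal.coe_ne_top,
      eLpNorm_eq_lintegral_rpow_enorm_toReal hpe ENNReal.coe_ne_top, ← ENNReal.rpow_mul,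
      ← ENNReal.rpow_mul, ENNReal.coe_toReal, one_div_mul_eq_div, one_div_mul_eq_div]
  have toReal_rhs : (eLpNorm X p P).toReal ^ ((p : ℝ) - 2) * (eLpNorm Y p P).toReal ^ 2 =
      (eLpNorm X p P ^ ((p : ℝ) - 2) * eLpNorm Y p P ^ (2 : ℝ)).toReal := by
    rw [ENNReal.toReal_mul, ENNReal.toReal_rpow, ENNReal.rpow_two, ENNReal.toReal_pow]
  rw [integral_eq_lintegral_of_nonneg_ae (ae_of_all _ fun ω => by positivity)
    (integrable_norm_rpow_sub_two_mul_sq hp hX hY).1, toReal_rhs]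
  refine ENNReal.toReal_mono (ENNReal.mul_ne_top
    (ENNReal.rpow_ne_top_of_nonneg hp2 hX.eLpNorm_ne_top)
    (ENNReal.rpow_ne_top_of_nonneg zero_le_two hY.eLpNorm_ne_top)) (le_of_eq_of_le ?_ holder)
  refine lintegral_congr fun ω => ?_
  rw [ENNReal.ofReal_mul (by positivity), ← ENNReal.ofReal_rpow_of_nonneg (norm_nonneg _) hp2,
    ofReal_norm, ENNReal.ofReal_pow (norm_nonneg _), ofReal_norm, ENNReal.rpow_two]

variable [InnerProductSpace ℝ H]

lemma integrable_inner_norm_rpow_smul (hp : 2 ≤ p) (hX : MemLp X p P) (hY : MemLp Y p P) :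
    Integrable (fun ω => inner ℝ (‖X ω‖ ^ ((p : ℝ) - 2) • X ω) (Y ω)) P := by
  have hX2 := integrable_norm_rpow_sub_two_mul_sq hp hX hX
  have hXY2 := integrable_norm_rpow_sub_two_mul_sq hp hX hY
  have hZ : AEStronglyMeasurable (fun ω => ‖X ω‖ ^ ((p : ℝ) - 2) • X ω) P :=
    (hX.1.norm.aemeasurable.pow_const _).aestronglyMeasurable.smul hX.1
  refine (hX2.add hXY2).mono' (hZ.inner hY.1) (ae_of_all _ fun ω => ?_)
  have young : ‖inner ℝ (X ω) (Y ω)‖ ≤ ‖X ω‖ ^ 2 + ‖Y ω‖ ^ 2 :=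
    (norm_inner_le_norm (X ω) (Y ω)).trans <| by
      have : 0 ≤ ‖X ω‖ * ‖Y ω‖ := by positivity
      linarith [two_mul_le_add_sq ‖X ω‖ ‖Y ω‖]
  rw [real_inner_smul_left, norm_mul, Real.norm_of_nonneg (by positivity), Pi.add_apply, ← mul_add]
  gcongr

variable [CompleteSpace H]

lemma integral_inner_eq_zero_of_condExp_eq_zero [IsFiniteMeasure P] {m : MeasurableSpace Ω}
    (hm : m ≤ mΩ) {Z : Ω → H} (hZ : StronglyMeasurable[m] Z)
    (hZY : Integrable (fun ω => inner ℝ (Z ω) (Y ω)) P) (hY : Integrable Y P)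
    (h0 : P[Y | m] =ᵐ[P] 0) : ∫ ω, inner ℝ (Z ω) (Y ω) ∂P = 0 := by
  have h := condExp_bilin_of_stronglyMeasurable_left (innerSL ℝ (E := H)) hZ hZY hY
  rw [← integral_condExp hm]
  refine (integral_congr_ae (h.trans ?_)).trans (integral_zero _ _)
  filter_upwards [h0] with ω hω
  simp [hω]

lemma integral_norm_add_rpow_le [IsFiniteMeasure P] (hp : 2 ≤ p) {m : MeasurableSpace Ω}
    (hm : m ≤ mΩ) (hXm : StronglyMeasurable[m] X) (hX : MemLp X p P) (hY : MemLp Y p P)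
    (h0 : P[Y | m] =ᵐ[P] 0) :
    ∫ ω, ‖X ω + Y ω‖ ^ (p : ℝ) ∂P ≤ ∫ ω, ‖X ω‖ ^ (p : ℝ) ∂P +
      (p : ℝ) ^ 2 * 2 ^ (p : ℝ) / 2 *
        (∫ ω, ‖X ω‖ ^ ((p : ℝ) - 2) * ‖Y ω‖ ^ 2 ∂P + ∫ ω, ‖Y ω‖ ^ (p : ℝ) ∂P) := by
  have h1p : (1 : ℝ≥0∞) ≤ p := by exact_mod_cast one_le_two.trans hp
  have hiX := integrable_norm_rpow hp hX
  have hiY := integrable_norm_rpow hp hY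
  have hi2 := integrable_norm_rpow_sub_two_mul_sq hp hX hY
  have hiZ := integrable_inner_norm_rpow_smul hp hX hY
  have hZm : StronglyMeasurable[m] fun ω => ‖X ω‖ ^ ((p : ℝ) - 2) • X ω :=
    (hXm.norm.measurable.pow_const ((p : ℝ) - 2)).stronglyMeasurable.smul hXm
  have cross : ∫ ω, inner ℝ (‖X ω‖ ^ ((p : ℝ) - 2) • X ω) (Y ω) ∂P = 0 :=
    integral_inner_eq_zero_of_condExp_eq_zero hm hZm hiZ (hY.integrable h1p) h0
  calc ∫ ω, ‖X ω + Y ω‖ ^ (p : ℝ) ∂P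
      ≤ ∫ ω, (‖X ω‖ ^ (p : ℝ) + p * inner ℝ (‖X ω‖ ^ ((p : ℝ) - 2) • X ω) (Y ω) +
        (p : ℝ) ^ 2 * 2 ^ (p : ℝ) / 2 *
          (‖X ω‖ ^ ((p : ℝ) - 2) * ‖Y ω‖ ^ 2 + ‖Y ω‖ ^ (p : ℝ))) ∂P := by
        refine integral_mono (integrable_norm_rpow hp (hX.add hY))
          ((hiX.add (hiZ.const_mul _)).add ((hi2.add hiY).const_mul _)) fun ω => ?_
        simpa only [real_inner_smul_left] using
          norm_add_rpow_le (p := p) (by exact_mod_cast hp) (X ω) (Y ω)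
    _ = _ := (integral_add (hiX.add (hiZ.const_mul _)) ((hi2.add hiY).const_mul _)).trans <| by
        simp only [Pi.add_apply]
        rw [integral_add hiX (hiZ.const_mul _), integral_const_mul, integral_const_mul,
          integral_add hi2 hiY, cross, mul_zero, add_zero]

/-- The constant of 2-smoothness of `L^p(Ω; H)` along martingale differences. -/
noncomputable def smoothConst (p : ℝ≥0) : ℝ≥0 := p ^ 2 * 2 ^ (p : ℝ) + 1

lemma eLpNorm_add_sq_le [IsFiniteMeasure P] (hp : 2 ≤ p) {m : MeasurableSpace Ω} (hm : m ≤ mΩ)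
    (hXm : StronglyMeasurable[m] X) (hX : MemLp X p P) (hY : MemLp Y p P)
    (h0 : P[Y | m] =ᵐ[P] 0) :
    eLpNorm (X + Y) p P ^ 2 ≤ eLpNorm X p P ^ 2 + smoothConst p * eLpNorm Y p P ^ 2 := by
  have hp' : (2 : ℝ) ≤ p := by exact_mod_cast hp
  lift eLpNorm X p P to ℝ≥0 using hX.eLpNorm_ne_top with a ha
  lift eLpNorm Y p P to ℝ≥0 using hY.eLpNorm_ne_top with b hb
  lift eLpNorm (X + Y) p P to ℝ≥0 using (hX.add hY).eLpNorm_ne_top with c hc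
  norm_cast
  have key : ((c : ℝ) ^ 2) ^ ((p : ℝ) / 2) ≤
      ((a : ℝ) ^ 2 + smoothConst p * (b : ℝ) ^ 2) ^ ((p : ℝ) / 2) := by
    have moments := integral_norm_add_rpow_le hp hm hXm hX hY h0
    have holder := integral_norm_rpow_sub_two_mul_sq_le hp hX hY
    have hsum := integral_norm_rpow hp (hX.add hY)
    simp only [Pi.add_apply] at hsum
    rw [hsum, integral_norm_rpow hp hX, integral_norm_rpow hp hY, ← ha, ← hb, ← hc] at moments
    rw [← ha, ← hb] at holder
    simp only [ENNReal.coe_toReal] at moments holder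
    have scalar := rpow_add_mul_le_rpow (K := (p : ℝ) ^ 2 * 2 ^ (p : ℝ) / 2) hp' (by positivity)
      a.coe_nonneg b.coe_nonneg
    rw [mul_div_cancel₀ _ two_ne_zero] at scalar
    rw [sq_rpow_half c.coe_nonneg]
    refine (moments.trans ?_).trans scalar
    gcongr
  exact_mod_cast (Real.rpow_le_rpow_iff (by positivity) (by positivity) (by linarith)).1 key

end Martingale

section OneStep

/-- The constant `M` in the one-step estimate `‖Y‖² ≤ ‖X‖² + M h (‖X‖² + E²)`. -/
noncomputable def stepConst (p T L : ℝ≥0) : ℝ≥0 :=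
  4 * L + 3 * L ^ 2 * T + 3 * smoothConst p * L ^ 2

lemma mul_le_sq_add_sq (x y : ℝ≥0∞) : x * y ≤ x ^ 2 + y ^ 2 := by
  rcases le_total x y with h | h
  · exact (mul_le_mul_left h y).trans ((sq y).ge.trans le_add_self)
  · exact (mul_le_mul_right h x).trans ((sq x).ge.trans le_self_add)

lemma add_sq_le_three_mul (x y : ℝ≥0∞) : (x + y) ^ 2 ≤ 3 * (x ^ 2 + y ^ 2) :=
  calc (x + y) ^ 2 = x ^ 2 + y ^ 2 + 2 * (x * y) := by ring
    _ ≤ x ^ 2 + y ^ 2 + 2 * (x ^ 2 + y ^ 2) := by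
        gcongr
        exact mul_le_sq_add_sq x y
    _ = 3 * (x ^ 2 + y ^ 2) := by ring

lemma add_sq_add_smoothConst_mul_sq_le {p h T L : ℝ≥0} (hh : h ≤ T) {x a b E : ℝ≥0∞}
    (ha : a ≤ (L * h : ℝ≥0) * (x + E)) (hb : b ≤ (L * h ^ (1 / 2 : ℝ) : ℝ≥0) * (x + E)) :
    (x + a) ^ 2 + smoothConst p * b ^ 2 ≤ x ^ 2 + stepConst p T L * h * (x ^ 2 + E ^ 2) := by
  have sqrt_sq : (h ^ (1 / 2 : ℝ)) ^ 2 = h := by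
    rw [← NNReal.rpow_mul_natCast]
    norm_num
  have cross_le : x * (x + E) ≤ 2 * (x ^ 2 + E ^ 2) :=
    calc x * (x + E) = x ^ 2 + x * E := by ring
      _ ≤ (x ^ 2 + E ^ 2) + (x ^ 2 + E ^ 2) := add_le_add le_self_add (mul_le_sq_add_sq x E)
      _ = 2 * (x ^ 2 + E ^ 2) := by ring
  calc (x + a) ^ 2 + smoothConst p * b ^ 2
      ≤ (x + (L * h : ℝ≥0) * (x + E)) ^ 2 +
          smoothConst p * ((L * h ^ (1 / 2 : ℝ) : ℝ≥0) * (x + E)) ^ 2 := by gcongr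
    _ = x ^ 2 + 2 * L * h * (x * (x + E)) + L ^ 2 * h * h * (x + E) ^ 2 +
          smoothConst p * L ^ 2 * (((h ^ (1 / 2 : ℝ)) ^ 2 : ℝ≥0) * (x + E) ^ 2) := by
        push_cast
        ring
    _ ≤ x ^ 2 + 2 * L * h * (2 * (x ^ 2 + E ^ 2)) + L ^ 2 * h * T * (3 * (x ^ 2 + E ^ 2)) +
          smoothConst p * L ^ 2 * (h * (3 * (x ^ 2 + E ^ 2))) := by
        rw [sqrt_sq]
        gcongr <;> exact add_sq_le_three_mul x E
    _ = x ^ 2 + stepConst p T L * h * (x ^ 2 + E ^ 2) := by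
        simp only [stepConst, ENNReal.coe_add, ENNReal.coe_mul, ENNReal.coe_pow, ENNReal.coe_ofNat]
        ring

variable {p : ℝ≥0} {H : Type*} [NormedAddCommGroup H] [InnerProductSpace ℝ H] [CompleteSpace H]
  {Ω : Type*} {mΩ : MeasurableSpace Ω} {ℱ : Filtration ℝ≥0 mΩ} {P : Measure Ω} {X X' Y Y' : Ω → H}

lemma memLp_hatInc (hp : 1 ≤ p) (s : ℝ≥0) (hX : MemLp X p P) (hY : MemLp Y p P) :
    MemLp (hatInc ℱ P s X Y) p P :=
  (hY.sub hX).condExp (by exact_mod_cast hp)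

lemma memLp_tildeInc (hp : 1 ≤ p) (s : ℝ≥0) (hX : MemLp X p P) (hY : MemLp Y p P) :
    MemLp (tildeInc ℱ P s X Y) p P :=
  (hY.sub hX).sub (memLp_hatInc hp s hX hY)

lemma add_hatInc_add_tildeInc (s : ℝ≥0) (X Y : Ω → H) :
    X + hatInc ℱ P s X Y + tildeInc ℱ P s X Y = Y := by
  rw [tildeInc]
  abel

lemma condExp_tildeInc [IsFiniteMeasure P] (s : ℝ≥0) (hX : Integrable X P) (hY : Integrable Y P) :
    P[tildeInc ℱ P s X Y | ℱ s] =ᵐ[P] 0 := by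
  have hhat : Integrable (hatInc ℱ P s X Y) P := integrable_condExp
  refine (condExp_sub (hY.sub hX) hhat (ℱ s)).trans ?_
  rw [condExp_of_stronglyMeasurable (ℱ.le s) (f := hatInc ℱ P s X Y) stronglyMeasurable_condExp
    hhat, hatInc, sub_self]

lemma hatInc_sub (s : ℝ≥0) (hX : Integrable X P) (hX' : Integrable X' P) (hY : Integrable Y P)
    (hY' : Integrable Y' P) :
    hatInc ℱ P s (X' - X) (Y' - Y) =ᵐ[P] hatInc ℱ P s X' Y' - hatInc ℱ P s X Y := by
  rw [hatInc, sub_sub_sub_comm]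
  exact condExp_sub (hY'.sub hX') (hY.sub hX) (ℱ s)

lemma tildeInc_sub (s : ℝ≥0) (hX : Integrable X P) (hX' : Integrable X' P) (hY : Integrable Y P)
    (hY' : Integrable Y' P) :
    tildeInc ℱ P s (X' - X) (Y' - Y) =ᵐ[P] tildeInc ℱ P s X' Y' - tildeInc ℱ P s X Y := by
  filter_upwards [hatInc_sub (ℱ := ℱ) s hX hX' hY hY'] with ω hω
  simp only [tildeInc, Pi.sub_apply] at hω ⊢
  rw [hω]
  abel

lemma eLpNorm_sq_le_of_increment_le [IsFiniteMeasure P] (hp : 2 ≤ p) {s h T L : ℝ≥0} (hh : h ≤ T)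
    {E : ℝ≥0∞}
    (hXm : StronglyMeasurable[ℱ s] X) (hX : MemLp X p P) (hY : MemLp Y p P)
    (hat_le : eLpNorm (hatInc ℱ P s X Y) p P ≤ (L * h : ℝ≥0) * (eLpNorm X p P + E))
    (tilde_le : eLpNorm (tildeInc ℱ P s X Y) p P ≤
      (L * h ^ (1 / 2 : ℝ) : ℝ≥0) * (eLpNorm X p P + E)) :
    eLpNorm Y p P ^ 2 ≤
      eLpNorm X p P ^ 2 + stepConst p T L * h * (eLpNorm X p P ^ 2 + E ^ 2) := by
  have h1p : 1 ≤ p := one_le_two.trans hp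
  have h1p' : (1 : ℝ≥0∞) ≤ p := by exact_mod_cast h1p
  have hhat := memLp_hatInc (ℱ := ℱ) h1p s hX hY
  have hhatm : StronglyMeasurable[ℱ s] (hatInc ℱ P s X Y) := stronglyMeasurable_condExp
  calc eLpNorm Y p P ^ 2
      = eLpNorm (X + hatInc ℱ P s X Y + tildeInc ℱ P s X Y) p P ^ 2 := by
        rw [add_hatInc_add_tildeInc]
    _ ≤ eLpNorm (X + hatInc ℱ P s X Y) p P ^ 2 +
          smoothConst p * eLpNorm (tildeInc ℱ P s X Y) p P ^ 2 :=
        eLpNorm_add_sq_le hp (ℱ.le s) (hXm.add hhatm) (hX.add hhat) (memLp_tildeInc h1p s hX hY)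
          (condExp_tildeInc s (hX.integrable h1p') (hY.integrable h1p'))
    _ ≤ (eLpNorm X p P + eLpNorm (hatInc ℱ P s X Y) p P) ^ 2 +
          smoothConst p * eLpNorm (tildeInc ℱ P s X Y) p P ^ 2 := by
        gcongr
        exact eLpNorm_add_le hX.1 hhat.1 h1p'
    _ ≤ _ := add_sq_add_smoothConst_mul_sq_le hh hat_le tilde_le

end OneStep

section Coupled

variable {p : ℝ≥0} {H : Type*} [NormedAddCommGroup H] [MeasurableSpace H] {Ω : Type*}
  {mΩ : MeasurableSpace Ω} {ℱ : Filtration ℝ≥0 mΩ} {P : Measure Ω}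

lemma LpAt.measurable {s : ℝ≥0} (X : LpAt H p ℱ P s) : Measurable X.1 :=
  X.2.1.mono (ℱ.le s) le_rfl

/-- `μ` and `ν` are the laws of two random variables in `L^p_s(H)` whose squared `L^p`-distance is
at most `q`. -/
def Coupled (ℱ : Filtration ℝ≥0 mΩ) (P : Measure Ω) (s : ℝ≥0) (μ ν : PSpace p H) (q : ℝ≥0∞) :
    Prop :=
  ∃ X : LpAt H p ℱ P s × LpAt H p ℱ P s, P.map X.1.1 = μ.toMeasure ∧ P.map X.2.1 = ν.toMeasure ∧
    eLpNorm (X.1.1 - X.2.1) p P ^ 2 ≤ q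

lemma Coupled.mono {s : ℝ≥0} {μ ν : PSpace p H} {q q' : ℝ≥0∞} (h : Coupled ℱ P s μ ν q)
    (hq : q ≤ q') : Coupled ℱ P s μ ν q' :=
  let ⟨X, hX₁, hX₂, hX⟩ := h
  ⟨X, hX₁, hX₂, hX.trans hq⟩

variable [BorelSpace H] [SecondCountableTopology H]

lemma Coupled.W_sq_le {s : ℝ≥0} {μ ν : PSpace p H} {q : ℝ≥0∞} (h : Coupled ℱ P s μ ν q) :
    W μ ν ^ 2 ≤ q := by
  obtain ⟨X, hX₁, hX₂, hX⟩ := h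
  exact (pow_le_pow_left₀ zero_le (W_le_of_map X.1.measurable X.2.measurable hX₁ hX₂) 2).trans hX

lemma IsCoupling.coupled [CompleteSpace H] (hA : Atomless ℱ P) (s : ℝ≥0) {μ ν : PSpace p H}
    {Γ : Measure (H × H)}
    (hΓ : IsCoupling μ.toMeasure ν.toMeasure Γ) :
    Coupled ℱ P s μ ν (eLpNorm (fun z : H × H => z.1 - z.2) p Γ ^ 2) := by
  have := hΓ.isProbabilityMeasure
  obtain ⟨Z, hZ₀, hZΓ⟩ := hA.exists_measurable_map_eq Γ
  have hZs : Measurable[ℱ s] Z := hZ₀.mono (ℱ.mono zero_le) le_rfl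
  have hZ : Measurable Z := hZs.mono (ℱ.le s) le_rfl
  have fst_law : P.map (Prod.fst ∘ Z) = μ.toMeasure := by
    rw [← Measure.map_map measurable_fst hZ, hZΓ, hΓ.1]
  have snd_law : P.map (Prod.snd ∘ Z) = ν.toMeasure := by
    rw [← Measure.map_map measurable_snd hZ, hZΓ, hΓ.2]
  refine ⟨(⟨Prod.fst ∘ Z, measurable_fst.comp hZs, memLp_of_map_eq (by fun_prop) fst_law⟩,
    ⟨Prod.snd ∘ Z, measurable_snd.comp hZs, memLp_of_map_eq (by fun_prop) snd_law⟩),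
    fst_law, snd_law, le_of_eq ?_⟩
  rw [← hZΓ, eLpNorm_map_measure (by fun_prop) hZ.aemeasurable]
  rfl

lemma Coupled.of_W_lt [CompleteSpace H] (hA : Atomless ℱ P) (s : ℝ≥0) {μ ν : PSpace p H} {c : ℝ≥0∞}
    (h : W μ ν < c) : Coupled ℱ P s μ ν (c ^ 2) := by
  obtain ⟨Γ, hΓ, hlt⟩ := exists_isCoupling_eLpNorm_lt h
  exact (hΓ.coupled hA s).mono (pow_le_pow_left₀ zero_le hlt.le 2)

variable [InnerProductSpace ℝ H] [CompleteSpace H] [IsProbabilityMeasure P]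
  {Θ : ℝ≥0 → ℝ≥0 → PSpace p H → PSpace p H} {β : ℝ} {L C : ℝ≥0}
  {𝒳 : ∀ s _r t : ℝ≥0, LpAt H p ℱ P s × LpAt H p ℱ P s → LpAt H p ℱ P t × LpAt H p ℱ P t}

lemma IsCouplingFamily.norm_sq_le (h𝒳 : IsCouplingFamily ℱ P Θ β L C 𝒳) (hp : 2 ≤ p)
    (hA : Atomless ℱ P) {s t T : ℝ≥0} (hst : s ≤ t) (hT : t - s ≤ T) (μ : PSpace p H) :
    (Θ s t μ).norm ^ 2 ≤ μ.norm ^ 2 + stepConst p T L * (t - s : ℝ≥0) * (μ.norm ^ 2 + 1) := by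
  obtain ⟨Z, hZ₀, Z_law⟩ := hA.exists_measurable_map_eq μ.toMeasure
  have hZs : Measurable[ℱ s] Z := hZ₀.mono (ℱ.mono zero_le) le_rfl
  let X : LpAt H p ℱ P s := ⟨Z, hZs, memLp_of_map_eq (hZs.mono (ℱ.le s) le_rfl) Z_law⟩
  have X_norm : eLpNorm X.1 p P = μ.norm := eLpNorm_eq_of_map_eq X.measurable Z_law
  have Y_norm := eLpNorm_eq_of_map_eq (𝒳 s t t (X, X)).1.measurable
    (h𝒳.repr_one s t t hst le_rfl μ μ (X, X) Z_law Z_law)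
  have step := eLpNorm_sq_le_of_increment_le (E := 1) hp hT X.2.1.stronglyMeasurable X.2.2
    (𝒳 s t t (X, X)).1.2.2 (by simpa only [add_comm] using h𝒳.growth_hat s t t hst le_rfl (X, X))
    (by simpa only [add_comm] using h𝒳.growth_tilde s t t hst le_rfl (X, X))
  rwa [X_norm, Y_norm, one_pow] at step

lemma Coupled.step (h𝒳 : IsCouplingFamily ℱ P Θ β L C 𝒳) (hp : 2 ≤ p) {s r t T : ℝ≥0}
    (hsr : s ≤ r) (hrt : r ≤ t) (hT : t - s ≤ T) {μ ν : PSpace p H} {q E : ℝ≥0∞}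
    (hE : (1 + (μ.norm + ν.norm)) * ((t - s) ^ β : ℝ≥0) ≤ E) (h : Coupled ℱ P s μ ν q) :
    Coupled ℱ P t (Θ s t μ) (Θ r t (Θ s r ν))
      (q + stepConst p T C * (t - s : ℝ≥0) * (q + E ^ 2)) := by
  obtain ⟨X, hX₁, hX₂, hX⟩ := h
  set Y := 𝒳 s r t X
  have h1p : (1 : ℝ≥0∞) ≤ p := by exact_mod_cast one_le_two.trans hp
  have hX₁p := X.1.2.2
  have hX₂p := X.2.2.2
  have hY₁p := Y.1.2.2
  have hY₂p := Y.2.2.2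
  have bound_le : eLpNorm (X.1.1 - X.2.1) p P + (1 + (eLpNorm X.1.1 p P + eLpNorm X.2.1 p P)) *
      ((t - s) ^ β : ℝ≥0) ≤ eLpNorm (X.2.1 - X.1.1) p P + E := by
    rw [eLpNorm_sub_comm, eLpNorm_eq_of_map_eq X.1.measurable hX₁,
      eLpNorm_eq_of_map_eq X.2.measurable hX₂]
    gcongr
  refine ⟨Y, h𝒳.repr_one s r t hsr hrt μ ν X hX₁ hX₂, h𝒳.repr_two s r t hsr hrt μ ν X hX₁ hX₂, ?_⟩
  have step := eLpNorm_sq_le_of_increment_le (E := E) (L := C) hp hT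
    (X.2.2.1.stronglyMeasurable.sub X.1.2.1.stronglyMeasurable) (hX₂p.sub hX₁p) (hY₂p.sub hY₁p)
    (by
      rw [eLpNorm_congr_ae (hatInc_sub s (hX₁p.integrable h1p) (hX₂p.integrable h1p)
        (hY₁p.integrable h1p) (hY₂p.integrable h1p))]
      exact (h𝒳.sewing_hat s r t hsr hrt X).trans (by gcongr))
    (by
      rw [eLpNorm_congr_ae (tildeInc_sub s (hX₁p.integrable h1p) (hX₂p.integrable h1p)
        (hY₁p.integrable h1p) (hY₂p.integrable h1p))]
      exact (h𝒳.sewing_tilde s r t hsr hrt X).trans (by gcongr))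
  rw [eLpNorm_sub_comm, eLpNorm_sub_comm X.2.1] at step
  exact step.trans (by gcongr)

end Coupled

section Run

variable {E : Type*}

/-- The composition of `Θ` along a decreasing list of times, the head of the list being the time
reached last. -/
def runList (Θ : ℝ≥0 → ℝ≥0 → E → E) : List ℝ≥0 → E → E
  | [], μ => μ
  | [_], μ => μ
  | t :: u :: l, μ => Θ u t (runList Θ (u :: l) μ)

/-- The composition of `Θ` along the increasing enumeration of a finite set of times. Partitions
are encoded as finite sets, so that they can be refined by taking unions. -/
noncomputable def run (Θ : ℝ≥0 → ℝ≥0 → E → E) (S : Finset ℝ≥0) : E → E :=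
  runList Θ (S.sort (· ≥ ·))

/-- `S` is the set of points of a partition of `[s, t]`. -/
structure IsPart (s t : ℝ≥0) (S : Finset ℝ≥0) : Prop where
  left_mem : s ∈ S
  right_mem : t ∈ S
  left_le : ∀ x ∈ S, s ≤ x
  le_right : ∀ x ∈ S, x ≤ t

/-- The gaps of `S` in `[s, t]` have length at most `h`. -/
def IsFine (h s t : ℝ≥0) (S : Finset ℝ≥0) : Prop :=
  ∀ x, s ≤ x → x < t → ∃ y ∈ S, x < y ∧ y ≤ x + h

/-- `B` is obtained from `A` by inserting at most one point into each gap. -/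
structure SimpleInsertion (A B : Finset ℝ≥0) : Prop where
  subset : A ⊆ B
  exists_between : ∀ x ∈ B, x ∉ A → ∀ y ∈ B, y ∉ A → x < y → ∃ z ∈ A, x < z ∧ z < y

variable {Θ : ℝ≥0 → ℝ≥0 → E → E} {h s r t u : ℝ≥0} {S A B D : Finset ℝ≥0}

namespace IsPart

lemma le (h : IsPart s t S) : s ≤ t := h.left_le t h.right_mem

lemma singleton (s : ℝ≥0) : IsPart s s {s} := ⟨by simp, by simp, by simp, by simp⟩

lemma eq_singleton (h : IsPart s s S) : S = {s} :=
  Finset.eq_singleton_iff_unique_mem.2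
    ⟨h.left_mem, fun x hx => le_antisymm (h.le_right x hx) (h.left_le x hx)⟩

lemma pair (h : s ≤ t) : IsPart s t {s, t} := ⟨by simp, by simp, by simp [h], by simp [h]⟩

lemma append (hA : IsPart s r A) (hB : IsPart r t B) : IsPart s t (A ∪ B) where
  left_mem := Finset.mem_union_left _ hA.left_mem
  right_mem := Finset.mem_union_right _ hB.right_mem
  left_le x hx := (Finset.mem_union.1 hx).elim (hA.left_le x) fun h => hA.le.trans (hB.left_le x h)
  le_right x hx :=
    (Finset.mem_union.1 hx).elim (fun h => (hA.le_right x h).trans hB.le) (hB.le_right x)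

lemma union (hA : IsPart s t A) (hB : IsPart s t B) : IsPart s t (A ∪ B) where
  left_mem := Finset.mem_union_left _ hA.left_mem
  right_mem := Finset.mem_union_left _ hA.right_mem
  left_le x hx := (Finset.mem_union.1 hx).elim (hA.left_le x) (hB.left_le x)
  le_right x hx := (Finset.mem_union.1 hx).elim (hA.le_right x) (hB.le_right x)

lemma insert_right (h : IsPart s u S) (hut : u ≤ t) : IsPart s t (insert t S) := by
  convert h.append (pair hut) using 1
  rw [Finset.union_insert, Finset.insert_eq_of_mem (Finset.mem_union_left _ h.right_mem),
    Finset.union_singleton]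

lemma filter_le (h : IsPart s t S) (hr : r ∈ S) : IsPart s r (S.filter (· ≤ r)) where
  left_mem := Finset.mem_filter.2 ⟨h.left_mem, h.left_le r hr⟩
  right_mem := Finset.mem_filter.2 ⟨hr, le_rfl⟩
  left_le x hx := h.left_le x (Finset.mem_filter.1 hx).1
  le_right _ hx := (Finset.mem_filter.1 hx).2

lemma induction {Q : Finset ℝ≥0 → ℝ≥0 → Prop} (singleton : Q {s} s)
    (insert : ∀ S u t, IsPart s u S → u < t → Q S u → Q (insert t S) t) (h : IsPart s t S) :
    Q S t := by
  induction S using Finset.induction_on_max generalizing t with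
  | empty => exact absurd h.left_mem (Finset.notMem_empty s)
  | insert a S ha ih =>
    obtain rfl : t = a := by
      refine le_antisymm ?_ (h.le_right a (Finset.mem_insert_self _ _))
      exact (Finset.mem_insert.1 h.right_mem).elim le_of_eq fun ht => (ha t ht).le
    rcases S.eq_empty_or_nonempty with rfl | ⟨x, hx⟩
    · obtain rfl : s = t := by simpa using h.left_mem
      exact singleton
    · have hsx : s ≤ x := h.left_le x (Finset.mem_insert_of_mem hx)
      have hs : s ∈ S := Finset.mem_of_mem_insert_of_ne h.left_mem (hsx.trans_lt (ha x hx)).ne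
      have hS : IsPart s (S.max' ⟨x, hx⟩) S := ⟨hs, S.max'_mem _,
        fun y hy => h.left_le y (Finset.mem_insert_of_mem hy), fun y hy => S.le_max' y hy⟩
      exact insert S _ t hS (ha _ (S.max'_mem _)) (ih hS)

end IsPart

lemma run_singleton (s : ℝ≥0) (μ : E) : run Θ {s} μ = μ := by
  rw [run, Finset.sort_singleton, runList]

lemma run_insert (h : IsPart s u S) (hut : u < t) (μ : E) :
    run Θ (insert t S) μ = Θ u t (run Θ S μ) := by
  have sort_insert : (insert t S).sort (· ≥ ·) = t :: S.sort (· ≥ ·) :=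
    Finset.sort_insert _ (fun b hb => (h.le_right b hb).trans hut.le)
      (fun ht => (h.le_right t ht).not_gt hut)
  have sort_eq : S.sort (· ≥ ·) = u :: (S.erase u).sort (· ≥ ·) := by
    conv_lhs => rw [← Finset.insert_erase h.right_mem]
    exact Finset.sort_insert _ (fun b hb => h.le_right b (Finset.mem_of_mem_erase hb))
      (Finset.notMem_erase _ _)
  rw [run, run, sort_insert, sort_eq, runList]

lemma run_insert_of_le (hΘ : ∀ t, Θ t t = id) (h : IsPart s u S) (hut : u ≤ t) (μ : E) :
    run Θ (insert t S) μ = Θ u t (run Θ S μ) := by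
  rcases hut.eq_or_lt with rfl | hut
  · rw [Finset.insert_eq_of_mem h.right_mem, hΘ, id]
  · exact run_insert h hut μ

lemma run_pair (hΘ : ∀ t, Θ t t = id) (hst : s ≤ t) (μ : E) : run Θ {s, t} μ = Θ s t μ := by
  rw [Finset.pair_comm, run_insert_of_le hΘ (.singleton s) hst, run_singleton]

lemma run_union (hA : IsPart s r A) (hB : IsPart r t B) (μ : E) :
    run Θ (A ∪ B) μ = run Θ B (run Θ A μ) := by
  refine hB.induction (Q := fun B _ => run Θ (A ∪ B) μ = run Θ B (run Θ A μ)) ?_ ?_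
  · rw [Finset.union_eq_left.2 (Finset.singleton_subset_iff.2 hA.right_mem), run_singleton]
  · intro S u t hS hut ih
    rw [Finset.union_insert, run_insert (hA.append hS) hut, run_insert hS hut, ih]

lemma isPart_image {τ : ℕ → ℝ≥0} {N : ℕ} (hτ : ∀ i < N, τ i ≤ τ (i + 1)) :
    IsPart (τ 0) (τ N) ((Finset.range (N + 1)).image τ) := by
  induction N with
  | zero => exact .singleton _
  | succ N ih =>
    rw [Finset.range_add_one, Finset.image_insert]
    exact (ih fun i hi => hτ i (hi.trans N.lt_succ_self)).insert_right (hτ N N.lt_succ_self)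

lemma compose_eq_run (hΘ : ∀ t, Θ t t = id) {τ : ℕ → ℝ≥0} {N : ℕ}
    (hτ : ∀ i < N, τ i ≤ τ (i + 1)) (μ : E) :
    compose Θ τ N μ = run Θ ((Finset.range (N + 1)).image τ) μ := by
  induction N with
  | zero => exact (run_singleton _ _).symm
  | succ N ih =>
    have hτ' : ∀ i < N, τ i ≤ τ (i + 1) := fun i hi => hτ i (hi.trans N.lt_succ_self)
    rw [Finset.range_add_one, Finset.image_insert,
      run_insert_of_le hΘ (isPart_image hτ') (hτ N N.lt_succ_self), ← ih hτ', compose]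

lemma IsFine.mono (hA : IsFine h s t A) (hAB : A ⊆ B) : IsFine h s t B :=
  fun x hx hxt => let ⟨y, hy, hxy⟩ := hA x hx hxt; ⟨y, hAB hy, hxy⟩

lemma IsFine.insert_right (hA : IsFine h s u A) (ht : t ≤ u + h) : IsFine h s t (insert t A) := by
  intro x hsx hxt
  rcases lt_or_ge x u with hxu | hux
  · obtain ⟨y, hy, hxy⟩ := hA x hsx hxu
    exact ⟨y, Finset.mem_insert_of_mem hy, hxy⟩
  · exact ⟨t, Finset.mem_insert_self _ _, hxt, ht.trans (by gcongr)⟩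

lemma isFine_insert_iff (hA : IsPart s u A) (hut : u < t) :
    IsFine h s t (insert t A) ↔ IsFine h s u A ∧ t ≤ u + h := by
  refine ⟨fun hfine => ⟨fun x hsx hxu => ?_, ?_⟩, fun ⟨hfine, ht⟩ => hfine.insert_right ht⟩
  · obtain ⟨y, hy, hxy, hyh⟩ := hfine x hsx (hxu.trans hut)
    rcases Finset.mem_insert.1 hy with rfl | hy
    · exact ⟨u, hA.right_mem, hxu, hut.le.trans hyh⟩
    · exact ⟨y, hy, hxy, hyh⟩
  · obtain ⟨y, hy, huy, hyh⟩ := hfine u hA.le hut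
    rcases Finset.mem_insert.1 hy with rfl | hy
    · exact hyh
    · exact absurd (hA.le_right y hy) huy.not_ge

namespace SimpleInsertion

lemma eq_of_mem_gap (h : SimpleInsertion (insert t A) B) (hA : IsPart s u A) {x y : ℝ≥0}
    (hx : x ∈ B) (hy : y ∈ B) (hux : u < x) (hxt : x < t) (huy : u < y) (hyt : y < t) :
    x = y := by
  have notMem : ∀ w, u < w → w < t → w ∉ insert t A := fun w huw hwt hw =>
    (Finset.mem_insert.1 hw).elim hwt.ne fun hw => (hA.le_right w hw).not_gt huw
  wlog hxy : x < y generalizing x y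
  · rcases (not_lt.1 hxy).eq_or_lt with h | h
    exacts [h.symm, (this hy hx huy hyt hux hxt h).symm]
  obtain ⟨z, hz, hxz, hzy⟩ :=
    h.exists_between x hx (notMem x hux hxt) y hy (notMem y huy hyt) hxy
  exact absurd hz (notMem z (hux.trans hxz) (hzy.trans hyt))

lemma filter_le (h : SimpleInsertion (insert t A) B) (hA : IsPart s u A) (hut : u < t) :
    SimpleInsertion A (B.filter (· ≤ u)) := by
  refine ⟨fun x hx => Finset.mem_filter.2 ⟨h.subset (Finset.mem_insert_of_mem hx),
    hA.le_right x hx⟩, fun x hx hxA y hy hyA hxy => ?_⟩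
  have notMem : ∀ w ≤ u, w ∉ A → w ∉ insert t A := fun w hwu hw =>
    Finset.mem_insert.not.2 (not_or.2 ⟨(hwu.trans_lt hut).ne, hw⟩)
  rw [Finset.mem_filter] at hx hy
  obtain ⟨z, hz, hxz, hzy⟩ :=
    h.exists_between x hx.1 (notMem x hx.2 hxA) y hy.1 (notMem y hy.2 hyA) hxy
  exact ⟨z, Finset.mem_of_mem_insert_of_ne hz (hzy.trans (hy.2.trans_lt hut)).ne, hxz, hzy⟩

lemma exists_eq_insert_insert (h : SimpleInsertion (insert t A) B) (hA : IsPart s u A)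
    (hut : u < t) (hB : IsPart s t B) :
    ∃ r, u ≤ r ∧ r ≤ t ∧ B = insert t (insert r (B.filter (· ≤ u))) := by
  have ht := hB.right_mem
  by_cases hr : ∃ r ∈ B, u < r ∧ r < t
  · obtain ⟨r, hrB, hur, hrt⟩ := hr
    refine ⟨r, hur.le, hrt.le, ?_⟩
    ext x
    have := hB.le_right x
    have := fun hx hux hxt => h.eq_of_mem_gap hA (x := x) hx hrB hux hxt hur hrt
    grind
  · refine ⟨t, hut.le, le_rfl, ?_⟩
    ext x
    have := hB.le_right x
    grind

/-- Simultaneous induction over the gaps `[u, t]` of `A`, the point `r` being the one that `B` has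
in this gap, or an endpoint of the gap. -/
lemma induction {Q : Finset ℝ≥0 → Finset ℝ≥0 → ℝ≥0 → Prop} (singleton : Q {s} {s} s)
    (insert : ∀ A B u r t, IsPart s u A → IsPart s u B → u ≤ r → r ≤ t → t ≤ u + h →
      Q A B u → Q (insert t A) (insert t (insert r B)) t)
    (hA : IsPart s t A) (hB : IsPart s t B) (hAB : SimpleInsertion A B) (hfine : IsFine h s t A) :
    Q A B t := by
  revert B
  refine hA.induction (Q := fun A t => IsFine h s t A → ∀ {B}, IsPart s t B →
    SimpleInsertion A B → Q A B t) ?_ ?_ hfine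
  · intro _ B hB _
    rwa [hB.eq_singleton]
  · intro A u t hA hut ih hfine B hB hAB
    obtain ⟨hfine, htu⟩ := (isFine_insert_iff hA hut).1 hfine
    obtain ⟨r, hur, hrt, hBr⟩ := hAB.exists_eq_insert_insert hA hut hB
    have hB' := hB.filter_le (hAB.subset (Finset.mem_insert_of_mem hA.right_mem))
    rw [hBr]
    exact insert A _ u r t hA hB' hur hrt htu (ih hfine hB' (hAB.filter_le hA hut))

lemma union (hAB : SimpleInsertion A B) : SimpleInsertion (D ∪ A) (D ∪ B) := by
  refine ⟨Finset.union_subset_union_right hAB.subset, fun x hx hxA y hy hyA hxy => ?_⟩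
  simp only [Finset.mem_union, not_or] at hx hxA hy hyA
  obtain ⟨z, hz, hxz⟩ := hAB.exists_between x (hx.resolve_left hxA.1) hxA.2 y
    (hy.resolve_left hyA.1) hyA.2 hxy
  exact ⟨z, Finset.mem_union_right _ hz, hxz⟩

end SimpleInsertion

end Run

section Gronwall

/-- The exponential function with values in `[0, ∞)`, used for constants in estimates between
extended nonnegative numbers. -/
noncomputable def nnexp (x : ℝ≥0) : ℝ≥0 := ⟨Real.exp x, (Real.exp_pos x).le⟩

variable {M x y : ℝ≥0}

lemma nnexp_add (x y : ℝ≥0) : nnexp (x + y) = nnexp x * nnexp y :=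
  NNReal.eq (Real.exp_add x y)

lemma one_add_le_nnexp (x : ℝ≥0) : 1 + x ≤ nnexp x := by
  rw [add_comm]
  exact Real.add_one_le_exp (x : ℝ)

lemma one_le_nnexp (x : ℝ≥0) : 1 ≤ nnexp x := le_self_add.trans (one_add_le_nnexp x)

lemma nnexp_mono : Monotone nnexp := fun _ _ h => Real.exp_le_exp.2 h

/-- The bound at time `x` for a sequence with initial value `q` and increments at most
`M y (v + e)` over a time step of length `y` with initial value `v`. -/
noncomputable def discreteGronwall (M : ℝ≥0) (q e : ℝ≥0∞) (x : ℝ≥0) : ℝ≥0∞ :=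
  nnexp (M * x) * (q + (M * x : ℝ≥0) * e)

variable {q e v : ℝ≥0∞}

lemma le_discreteGronwall (M : ℝ≥0) (q e : ℝ≥0∞) (x : ℝ≥0) : q ≤ discreteGronwall M q e x :=
  le_mul_of_one_le_of_le (by exact_mod_cast one_le_nnexp _) le_self_add

lemma discreteGronwall_mono : Monotone (discreteGronwall M q e) := fun x y h => by
  have := nnexp_mono (mul_le_mul_right h M)
  unfold discreteGronwall
  gcongr

lemma add_mul_add_le_discreteGronwall (h : v ≤ discreteGronwall M q e x) (y : ℝ≥0) :
    v + M * y * (v + e) ≤ discreteGronwall M q e (x + y) := by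
  have one_add_le : 1 + (M * y : ℝ≥0∞) ≤ nnexp (M * y) := by
    exact_mod_cast one_add_le_nnexp (M * y)
  have one_le : (1 : ℝ≥0∞) ≤ nnexp (M * (x + y)) := by exact_mod_cast one_le_nnexp _
  calc v + M * y * (v + e) = (1 + M * y) * v + 1 * (M * y * e) := by ring
    _ ≤ nnexp (M * y) * discreteGronwall M q e x + nnexp (M * (x + y)) * (M * y * e) := by gcongr
    _ = discreteGronwall M q e (x + y) := by
      rw [discreteGronwall, discreteGronwall, mul_add M, nnexp_add]
      push_cast
      ring

end Gronwall

section Stability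

/-- Composing steps of `Θ` on `[0, T]` multiplies `1 + ‖·‖_p` by at most this factor. -/
noncomputable def growthConst (p T L : ℝ≥0) : ℝ≥0 :=
  3 * (nnexp (stepConst p T L * T) * (1 + stepConst p T L * T))

lemma one_le_growthConst (p T L : ℝ≥0) : 1 ≤ growthConst p T L :=
  one_le_mul_of_one_le_of_one_le (by norm_num)
    (one_le_mul_of_one_le_of_one_le (one_le_nnexp _) le_self_add)

/-- The constant in the stability estimate `IsStable` of a family with the sewing property. -/
noncomputable def stabilityConst (p T L C : ℝ≥0) : ℝ≥0 :=
  growthConst p T L +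
    nnexp (stepConst p T C * T) * (1 + stepConst p T C * (2 * growthConst p T L) ^ 2)

variable {p : ℝ≥0} {H : Type*} [NormedAddCommGroup H] [MeasurableSpace H]

/-- Stability of the compositions of `Θ` on subintervals of `[0, T]` with respect to the initial
measure and to insertion of points, with constant `M`. -/
structure IsStable (Θ : ℝ≥0 → ℝ≥0 → PSpace p H → PSpace p H) (β : ℝ) (T M : ℝ≥0) : Prop where
  W_run_le : ∀ {s t h : ℝ≥0} {A B : Finset ℝ≥0}, IsPart s t A → IsPart s t B →
    SimpleInsertion A B → IsFine h s t A → t ≤ T → ∀ μ ν : PSpace p H,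
      W (run Θ A μ) (run Θ B ν) ≤
        M * (W μ ν + (1 + (μ.norm + ν.norm)) * ((t - s) ^ (1 / 2 : ℝ) * h ^ β : ℝ≥0))
  norm_run_le : ∀ {s t : ℝ≥0} {S : Finset ℝ≥0}, IsPart s t S → t ≤ T → ∀ μ : PSpace p H,
    1 + (run Θ S μ).norm ≤ M * (1 + μ.norm)

variable [BorelSpace H] [SecondCountableTopology H] [InnerProductSpace ℝ H] [CompleteSpace H]
  {Ω : Type*} {mΩ : MeasurableSpace Ω} {ℱ : Filtration ℝ≥0 mΩ} {P : Measure Ω}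
  [IsProbabilityMeasure P] {Θ : ℝ≥0 → ℝ≥0 → PSpace p H → PSpace p H} {β : ℝ} {L C : ℝ≥0}
  {𝒳 : ∀ s _r t : ℝ≥0, LpAt H p ℱ P s × LpAt H p ℱ P s → LpAt H p ℱ P t × LpAt H p ℱ P t}
  {s t T h : ℝ≥0} {A B S : Finset ℝ≥0} {μ ν : PSpace p H} {c q : ℝ≥0∞}

namespace IsCouplingFamily

lemma norm_run_sq_le (h𝒳 : IsCouplingFamily ℱ P Θ β L C 𝒳) (hp : 2 ≤ p) (hA : Atomless ℱ P)
    (hS : IsPart s t S) (hT : t ≤ T) (μ : PSpace p H) :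
    (run Θ S μ).norm ^ 2 ≤ discreteGronwall (stepConst p T L) (μ.norm ^ 2) 1 (t - s) := by
  refine hS.induction (Q := fun S t => t ≤ T → (run Θ S μ).norm ^ 2 ≤
    discreteGronwall (stepConst p T L) (μ.norm ^ 2) 1 (t - s)) ?_ ?_ hT
  · rw [run_singleton]
    exact fun _ => le_discreteGronwall ..
  · intro S u t hS hut ih hT
    rw [run_insert hS hut, ← tsub_add_tsub_cancel hut.le hS.le, add_comm (t - u)]
    exact (h𝒳.norm_sq_le hp hA hut.le (tsub_le_self.trans hT) _).trans
      (add_mul_add_le_discreteGronwall (ih (hut.le.trans hT)) _)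

lemma one_add_norm_run_le (h𝒳 : IsCouplingFamily ℱ P Θ β L C 𝒳) (hp : 2 ≤ p)
    (hA : Atomless ℱ P) (hS : IsPart s t S) (hT : t ≤ T) (μ : PSpace p H) :
    1 + (run Θ S μ).norm ≤ growthConst p T L * (1 + μ.norm) := by
  set M := stepConst p T L
  have norm_sq_le : (run Θ S μ).norm ^ 2 ≤ nnexp (M * T) * (μ.norm ^ 2 + (M * T : ℝ≥0) * 1) :=
    (h𝒳.norm_run_sq_le hp hA hS hT μ).trans (discreteGronwall_mono (tsub_le_self.trans hT))
  have one_le : (1 : ℝ≥0∞) ≤ nnexp (M * T) := by exact_mod_cast one_le_nnexp _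
  have one_le_growth : (1 : ℝ≥0∞) ≤ growthConst p T L := by exact_mod_cast one_le_growthConst p T L
  refine (ENNReal.pow_le_pow_left_iff two_ne_zero).1 ?_
  calc (1 + (run Θ S μ).norm) ^ 2 ≤ 3 * (1 ^ 2 + (run Θ S μ).norm ^ 2) := add_sq_le_three_mul _ _
    _ ≤ 3 * (nnexp (M * T) + nnexp (M * T) * (μ.norm ^ 2 + (M * T : ℝ≥0) * 1)) := by
      rw [one_pow]
      gcongr
    _ ≤ 3 * (nnexp (M * T) + nnexp (M * T) * (μ.norm ^ 2 + (M * T : ℝ≥0) * 1)) +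
        3 * nnexp (M * T) * (2 * μ.norm + M * T * (2 * μ.norm + μ.norm ^ 2)) := le_self_add
    _ = growthConst p T L * (1 + μ.norm) ^ 2 := by
      rw [growthConst]
      push_cast
      ring
    _ ≤ growthConst p T L ^ 2 * (1 + μ.norm) ^ 2 := by
      gcongr
      exact le_self_pow one_le_growth two_ne_zero
    _ = (growthConst p T L * (1 + μ.norm)) ^ 2 := (mul_pow _ _ 2).symm

lemma coupled_run (h𝒳 : IsCouplingFamily ℱ P Θ β L C 𝒳) (hΘ : ∀ t, Θ t t = id) (hp : 2 ≤ p)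
    (hA : Atomless ℱ P) (hβ : 0 ≤ β) (hAp : IsPart s t A) (hBp : IsPart s t B)
    (hAB : SimpleInsertion A B) (hfine : IsFine h s t A) (hT : t ≤ T)
    (hc : Coupled ℱ P s μ ν q) :
    Coupled ℱ P t (run Θ A μ) (run Θ B ν) (discreteGronwall (stepConst p T C) q
      (((2 * growthConst p T L * h ^ β : ℝ≥0) * (1 + (μ.norm + ν.norm))) ^ 2) (t - s)) := by
  set G := growthConst p T L
  set E := ((2 * G * h ^ β : ℝ≥0) : ℝ≥0∞) * (1 + (μ.norm + ν.norm)) with hE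
  refine hAB.induction (Q := fun A B t => t ≤ T → Coupled ℱ P t (run Θ A μ) (run Θ B ν)
    (discreteGronwall (stepConst p T C) q (E ^ 2) (t - s))) ?_ ?_ hAp hBp hfine hT
  · intro _
    rw [run_singleton, run_singleton]
    exact hc.mono (le_discreteGronwall ..)
  · intro A B u r t hA' hB' hur hrt htu ih hT
    have hut := hur.trans hrt
    rw [run_insert_of_le hΘ hA' hut, run_insert_of_le hΘ (hB'.insert_right hur) hrt,
      run_insert_of_le hΘ hB' hur, ← tsub_add_tsub_cancel hut hA'.le, add_comm (t - u)]
    have hμ := h𝒳.one_add_norm_run_le hp hA hA' (hut.trans hT) μ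
    have hν := h𝒳.one_add_norm_run_le hp hA hB' (hut.trans hT) ν
    have norm_le : 1 + ((run Θ A μ).norm + (run Θ B ν).norm) ≤
        2 * G * (1 + (μ.norm + ν.norm)) := by
      calc _ ≤ (1 + (run Θ A μ).norm) + (1 + (run Θ B ν).norm) := by
            rw [add_add_add_comm]
            gcongr
            exact le_self_add
        _ ≤ G * (1 + (μ.norm + ν.norm)) + G * (1 + (μ.norm + ν.norm)) := by
            refine add_le_add (hμ.trans ?_) (hν.trans ?_) <;> gcongr
            exacts [le_self_add, le_add_self]
        _ = _ := by ring
    have hE' : (1 + ((run Θ A μ).norm + (run Θ B ν).norm)) * ((t - u) ^ β : ℝ≥0) ≤ E := by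
      have := NNReal.rpow_le_rpow (tsub_le_iff_left.2 htu) hβ
      calc _ ≤ 2 * G * (1 + (μ.norm + ν.norm)) * (h ^ β : ℝ≥0) := by gcongr
        _ = E := by rw [hE]; push_cast; ring
    exact (Coupled.step h𝒳 hp hur hrt (tsub_le_self.trans hT) hE' (ih (hut.trans hT))).mono
      (add_mul_add_le_discreteGronwall le_rfl _)

lemma W_run_le_of_lt (h𝒳 : IsCouplingFamily ℱ P Θ β L C 𝒳) (hΘ : ∀ t, Θ t t = id) (hp : 2 ≤ p)
    (hA : Atomless ℱ P) (hβ : 0 ≤ β) (hAp : IsPart s t A) (hBp : IsPart s t B)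
    (hAB : SimpleInsertion A B) (hfine : IsFine h s t A) (hT : t ≤ T) (hc : W μ ν < c) :
    W (run Θ A μ) (run Θ B ν) ≤ stabilityConst p T L C *
      (c + (1 + (μ.norm + ν.norm)) * ((t - s) ^ (1 / 2 : ℝ) * h ^ β : ℝ≥0)) := by
  set M := stepConst p T C
  set G := growthConst p T L
  set N := stabilityConst p T L C
  set R : ℝ≥0∞ := (1 + (μ.norm + ν.norm)) * ((t - s) ^ (1 / 2 : ℝ) * h ^ β : ℝ≥0) with hR
  have one_le_N : (1 : ℝ≥0∞) ≤ N := by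
    exact_mod_cast (one_le_growthConst p T L).trans le_self_add
  have le_N : (nnexp (M * T) * (1 + M * (2 * G) ^ 2) : ℝ≥0∞) ≤ N := by
    exact_mod_cast (le_add_self : _ ≤ N)
  have mul_sq_eq : ((M * (t - s) : ℝ≥0) : ℝ≥0∞) *
      ((2 * G * h ^ β : ℝ≥0) * (1 + (μ.norm + ν.norm))) ^ 2 = M * (2 * G) ^ 2 * R ^ 2 := by
    have sq_rpow_half : ((t - s) ^ (1 / 2 : ℝ)) ^ 2 = t - s := by
      rw [← NNReal.sqrt_eq_rpow, NNReal.sq_sqrt]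
    conv_lhs => rw [← sq_rpow_half]
    rw [hR]
    push_cast
    ring
  refine (ENNReal.pow_le_pow_left_iff two_ne_zero).1 ?_
  calc W (run Θ A μ) (run Θ B ν) ^ 2
      ≤ nnexp (M * (t - s)) * (c ^ 2 + M * (2 * G) ^ 2 * R ^ 2) := by
        rw [← mul_sq_eq]
        exact (h𝒳.coupled_run hΘ hp hA hβ hAp hBp hAB hfine hT (.of_W_lt hA s hc)).W_sq_le
    _ ≤ nnexp (M * T) * (c ^ 2 + M * (2 * G) ^ 2 * R ^ 2 +
          (R ^ 2 + 2 * c * R + M * (2 * G) ^ 2 * (c ^ 2 + 2 * c * R))) := by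
        have := nnexp_mono (mul_le_mul_right (tsub_le_self.trans hT : t - s ≤ T) M)
        exact mul_le_mul' (by exact_mod_cast this) le_self_add
    _ = nnexp (M * T) * (1 + M * (2 * G) ^ 2) * (c + R) ^ 2 := by ring
    _ ≤ N ^ 2 * (c + R) ^ 2 := by
        gcongr
        exact le_N.trans (le_self_pow one_le_N two_ne_zero)
    _ = (N * (c + R)) ^ 2 := (mul_pow _ _ 2).symm

lemma isStable (h𝒳 : IsCouplingFamily ℱ P Θ β L C 𝒳) (hΘ : ∀ t, Θ t t = id) (hp : 2 ≤ p)
    (hA : Atomless ℱ P) (hβ : 0 ≤ β) (T : ℝ≥0) : IsStable Θ β T (stabilityConst p T L C) where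
  W_run_le {s t h A B} hAp hBp hAB hfine hT μ ν := by
    have ne_zero : (stabilityConst p T L C : ℝ≥0∞) ≠ 0 := by
      exact_mod_cast (zero_lt_one.trans_le ((one_le_growthConst p T L).trans le_self_add)).ne'
    rcases eq_or_ne (W μ ν) ∞ with htop | htop
    · rw [htop, top_add, ENNReal.mul_top ne_zero]
      exact le_top
    · have : (𝓝[>] W μ ν).NeBot := nhdsGT_neBot_of_exists_gt ⟨∞, htop.lt_top⟩
      refine ge_of_tendsto (x := 𝓝[>] W μ ν)
        (((ENNReal.continuous_const_mul ENNReal.coe_ne_top).comp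
          (continuous_id.add continuous_const)).continuousWithinAt) ?_
      filter_upwards [self_mem_nhdsWithin] with c hc
      exact h𝒳.W_run_le_of_lt hΘ hp hA hβ hAp hBp hAB hfine hT hc
  norm_run_le hS hT μ := by
    refine (h𝒳.one_add_norm_run_le hp hA hS hT μ).trans ?_
    gcongr
    exact le_self_add

end IsCouplingFamily

end Stability

section Grid

variable {h s t δ : ℝ≥0} {A B : Finset ℝ≥0} {x y : ℝ≥0}

lemma IsFine.simpleInsertion_union (hA : IsFine h s t A) (hB : IsPart s t B)
    (hsep : ∀ x ∈ B, x ∉ A → ∀ y ∈ B, y ∉ A → x < y → x + h ≤ y) :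
    SimpleInsertion A (A ∪ B) := by
  refine ⟨Finset.subset_union_left, fun x hx hxA y hy hyA hxy => ?_⟩
  have hx := (Finset.mem_union.1 hx).resolve_left hxA
  have hy := (Finset.mem_union.1 hy).resolve_left hyA
  obtain ⟨z, hz, hxz, hzh⟩ := hA x (hB.left_le x hx) (hxy.trans_le (hB.le_right y hy))
  exact ⟨z, hz, hxz, (hzh.trans (hsep x hx hxA y hy hyA hxy)).lt_of_ne fun h => hyA (h ▸ hz)⟩

/-- The partition of `[s, t]` by the multiples of `δ` in `[s, t]`. -/
noncomputable def grid (δ s t : ℝ≥0) : Finset ℝ≥0 :=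
  insert s (insert t (((Finset.range (⌊t / δ⌋₊ + 1)).image fun k : ℕ => k * δ).filter
    fun x => s ≤ x ∧ x ≤ t))

lemma mem_grid (hδ : 0 < δ) :
    x ∈ grid δ s t ↔ x = s ∨ x = t ∨ ∃ k : ℕ, k * δ = x ∧ s ≤ x ∧ x ≤ t := by
  simp only [grid, Finset.mem_insert, Finset.mem_filter, Finset.mem_image, Finset.mem_range]
  refine or_congr Iff.rfl (or_congr Iff.rfl ⟨?_, ?_⟩)
  · rintro ⟨⟨k, -, hk⟩, h⟩
    exact ⟨k, hk, h⟩
  · rintro ⟨k, rfl, h⟩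
    exact ⟨⟨k, Nat.lt_succ_of_le (Nat.le_floor ((le_div_iff₀ hδ).2 h.2)), rfl⟩, h⟩

lemma mul_mem_grid (hδ : 0 < δ) {k : ℕ} (hs : s ≤ k * δ) (ht : k * δ ≤ t) :
    k * δ ∈ grid δ s t :=
  (mem_grid hδ).2 (Or.inr (Or.inr ⟨k, rfl, hs, ht⟩))

lemma isPart_grid (hδ : 0 < δ) (hst : s ≤ t) : IsPart s t (grid δ s t) where
  left_mem := (mem_grid hδ).2 (Or.inl rfl)
  right_mem := (mem_grid hδ).2 (Or.inr (Or.inl rfl))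
  left_le x hx := by
    rcases (mem_grid hδ).1 hx with rfl | rfl | ⟨k, -, h⟩
    exacts [le_rfl, hst, h.1]
  le_right x hx := by
    rcases (mem_grid hδ).1 hx with rfl | rfl | ⟨k, -, h⟩
    exacts [hst, le_rfl, h.2]

lemma isFine_grid (hδ : 0 < δ) : IsFine δ s t (grid δ s t) := by
  intro x hsx hxt
  have lt_next : x < (⌊x / δ⌋₊ + 1 : ℕ) * δ := by
    rw [← div_lt_iff₀ hδ]
    exact_mod_cast Nat.lt_floor_add_one (x / δ)
  have next_le : (⌊x / δ⌋₊ + 1 : ℕ) * δ ≤ x + δ := by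
    push_cast
    rw [add_mul, one_mul]
    gcongr
    exact (le_div_iff₀ hδ).1 (Nat.floor_le zero_le)
  rcases le_total ((⌊x / δ⌋₊ + 1 : ℕ) * δ) t with h | h
  · exact ⟨_, mul_mem_grid hδ (hsx.trans lt_next.le) h, lt_next, next_le⟩
  · exact ⟨t, (mem_grid hδ).2 (Or.inr (Or.inl rfl)), hxt, h.trans next_le⟩

lemma exists_eq_mul_of_mem_grid (hδ : 0 < δ) (hA : IsPart s t A) (hx : x ∈ grid δ s t)
    (hxA : x ∉ A) : ∃ k : ℕ, k * δ = x := by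
  rcases (mem_grid hδ).1 hx with rfl | rfl | ⟨k, hk, -⟩
  exacts [absurd hA.left_mem hxA, absurd hA.right_mem hxA, ⟨k, hk⟩]

lemma add_one_le_of_mul_lt_mul {k l : ℕ} (h : k * δ < l * δ) : k + 1 ≤ l :=
  Nat.cast_lt.1 (lt_of_mul_lt_mul_right h zero_le)

lemma simpleInsertion_grid_two_mul (hδ : 0 < δ) (hst : s ≤ t) :
    SimpleInsertion (grid (2 * δ) s t) (grid δ s t) := by
  have h2δ : 0 < 2 * δ := by positivity
  have hp := isPart_grid h2δ hst
  have hp' := isPart_grid hδ hst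
  have subset : grid (2 * δ) s t ⊆ grid δ s t := by
    intro x hx
    rw [mem_grid h2δ] at hx
    refine (mem_grid hδ).2 (hx.imp_right (Or.imp_right ?_))
    rintro ⟨k, rfl, h⟩
    exact ⟨2 * k, by push_cast; ring, h⟩
  have odd : ∀ k : ℕ, k * δ ∈ grid δ s t → k * δ ∉ grid (2 * δ) s t → Odd k := by
    intro k hk hk'
    by_contra heven
    obtain ⟨j, rfl⟩ := Nat.not_odd_iff_even.1 heven
    have e : ((j + j : ℕ) : ℝ≥0) * δ = j * (2 * δ) := by push_cast; ring
    rw [e] at hk hk'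
    exact hk' (mul_mem_grid h2δ (hp'.left_le _ hk) (hp'.le_right _ hk))
  rw [← Finset.union_eq_right.2 subset]
  refine (isFine_grid h2δ).simpleInsertion_union hp' fun x hx hxA y hy hyA hxy => ?_
  obtain ⟨k, rfl⟩ := exists_eq_mul_of_mem_grid hδ hp hx hxA
  obtain ⟨l, rfl⟩ := exists_eq_mul_of_mem_grid hδ hp hy hyA
  have hkl : k + 2 ≤ l := by
    have := add_one_le_of_mul_lt_mul hxy
    obtain ⟨i, rfl⟩ := odd k hx hxA
    obtain ⟨j, rfl⟩ := odd l hy hyA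
    lia
  calc (k : ℝ≥0) * δ + 2 * δ = (k + 2 : ℕ) * δ := by push_cast; ring
    _ ≤ l * δ := by gcongr

lemma IsFine.simpleInsertion_union_grid (hA : IsFine h s t A) (hAp : IsPart s t A)
    (hδ : 0 < δ) (hδh : h ≤ δ) : SimpleInsertion A (A ∪ grid δ s t) := by
  refine hA.simpleInsertion_union (isPart_grid hδ hAp.le) fun x hx hxA y hy hyA hxy => ?_
  obtain ⟨k, rfl⟩ := exists_eq_mul_of_mem_grid hδ hAp hx hxA
  obtain ⟨l, rfl⟩ := exists_eq_mul_of_mem_grid hδ hAp hy hyA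
  calc (k : ℝ≥0) * δ + h ≤ k * δ + δ := by gcongr
    _ = (k + 1 : ℕ) * δ := by push_cast; ring
    _ ≤ l * δ := by
      gcongr
      exact add_one_le_of_mul_lt_mul hxy

lemma eventually_simpleInsertion_grid_union (hA : IsPart s t A) :
    ∀ᶠ δ in 𝓝[>] 0, SimpleInsertion (grid δ s t) (grid δ s t ∪ A) := by
  have eventually_le : ∀ᶠ δ : ℝ≥0 in 𝓝[>] 0, ∀ x ∈ A, ∀ y ∈ A, x < y → x + δ ≤ y := by
    simp only [Filter.eventually_all_finset, Filter.eventually_imp_distrib_left]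
    intro x _ y _ hxy
    have tendsto_add : Tendsto (fun δ : ℝ≥0 => x + δ) (𝓝[>] 0) (𝓝 (x + 0)) :=
      (tendsto_id.mono_left nhdsWithin_le_nhds).const_add x
    rw [add_zero] at tendsto_add
    exact tendsto_add.eventually_le_const hxy
  filter_upwards [eventually_le, self_mem_nhdsWithin] with δ hle hδ
  exact (isFine_grid hδ).simpleInsertion_union hA fun x hx _ y hy _ => hle x hx y hy

end Grid

section GridEstimate

/-- The sum of the geometric series of the powers of `2 ^ (-β)`. -/
noncomputable def dyadicSum (β : ℝ) : ℝ≥0 := (1 - (2 ^ β)⁻¹)⁻¹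

lemma two_rpow_inv_lt_one {β : ℝ} (hβ : 0 < β) : (2 ^ β : ℝ≥0)⁻¹ < 1 :=
  inv_lt_one_of_one_lt₀ (NNReal.one_lt_rpow one_lt_two hβ)

lemma two_rpow_add_dyadicSum {β : ℝ} (hβ : 0 < β) :
    2 ^ β + dyadicSum β = dyadicSum β * 2 ^ β := by
  have ne_zero : 1 - (2 ^ β : ℝ≥0)⁻¹ ≠ 0 := (tsub_pos_of_lt (two_rpow_inv_lt_one hβ)).ne'
  have add_eq : (2 ^ β : ℝ≥0)⁻¹ + (1 - (2 ^ β)⁻¹) = 1 :=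
    add_tsub_cancel_of_le (two_rpow_inv_lt_one hβ).le
  have : (2 ^ β : ℝ≥0) ≠ 0 := by simp
  unfold dyadicSum
  generalize 1 - (2 ^ β : ℝ≥0)⁻¹ = y at ne_zero add_eq
  field_simp at add_eq ⊢
  linear_combination add_eq

namespace IsStable

variable {p : ℝ≥0} {H : Type*} [NormedAddCommGroup H] [MeasurableSpace H] [BorelSpace H]
  [SecondCountableTopology H] {Θ : ℝ≥0 → ℝ≥0 → PSpace p H → PSpace p H} {β : ℝ}
  {T M s t h δ : ℝ≥0} {A B : Finset ℝ≥0}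

lemma W_run_le_of_simpleInsertion (hE : IsStable Θ β T M) (hA : IsPart s t A)
    (hB : IsPart s t B) (hAB : SimpleInsertion A B) (hfine : IsFine h s t A) (hT : t ≤ T)
    (μ : PSpace p H) :
    W (run Θ A μ) (run Θ B μ) ≤
      2 * M * (1 + μ.norm) * ((t - s) ^ (1 / 2 : ℝ) : ℝ≥0) * (h ^ β : ℝ≥0) := by
  have one_add_le : 1 + (μ.norm + μ.norm) ≤ 2 * (1 + μ.norm) := by
    rw [mul_add, two_mul μ.norm]
    gcongr
    norm_num
  calc W (run Θ A μ) (run Θ B μ)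
      ≤ M * (0 + (1 + (μ.norm + μ.norm)) * ((t - s) ^ (1 / 2 : ℝ) * h ^ β : ℝ≥0)) := by
        rw [← W_self μ]
        exact hE.W_run_le hA hB hAB hfine hT μ μ
    _ ≤ M * (2 * (1 + μ.norm) * ((t - s) ^ (1 / 2 : ℝ) * h ^ β : ℝ≥0)) := by
        rw [zero_add]
        gcongr
    _ = _ := by push_cast; ring

lemma W_run_union_grid_le [CompleteSpace H] (hE : IsStable Θ β T M) (hp : 1 ≤ p) (hβ : 0 < β)
    (hA : IsPart s t A) (hT : t ≤ T) (hδ : 0 < δ) (μ : PSpace p H) (n : ℕ) :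
    W (run Θ (A ∪ grid (2 ^ n * δ) s t) μ) (run Θ (A ∪ grid δ s t) μ) ≤
      2 * M * (1 + μ.norm) * ((t - s) ^ (1 / 2 : ℝ) : ℝ≥0) *
        (dyadicSum β * (2 ^ n * δ) ^ β : ℝ≥0) := by
  induction n with
  | zero => simp [W_self]
  | succ n ih =>
    set η := 2 ^ n * δ with hη
    have hη0 : 0 < η := by positivity
    have h2η0 : 0 < 2 * η := by positivity
    rw [pow_succ', mul_assoc, ← hη]
    have halving := hE.W_run_le_of_simpleInsertion (hA.union (isPart_grid h2η0 hA.le))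
      (hA.union (isPart_grid hη0 hA.le)) (simpleInsertion_grid_two_mul hη0 hA.le).union
      ((isFine_grid h2η0).mono Finset.subset_union_right) hT μ
    refine (W_triangle hp _ (run Θ (A ∪ grid η s t) μ) _).trans ((add_le_add halving ih).trans ?_)
    rw [← mul_add]
    gcongr
    rw [← ENNReal.coe_add, NNReal.mul_rpow (x := 2), ← add_mul, two_rpow_add_dyadicSum hβ,
      mul_assoc]

/-- The factor `1 + dyadicSum β * 2 ^ β` comes from inserting into `A` the first of the grids
`2 ^ n * δ` that is coarser than `A`, and then halving its mesh `n` times. -/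
lemma W_run_grid_le [CompleteSpace H] (hE : IsStable Θ β T M) (hp : 1 ≤ p) (hβ : 0 < β)
    (hA : IsPart s t A) (hT : t ≤ T) (hfine : IsFine h s t A) (hδ : 0 < δ) (hδh : δ ≤ h)
    (hins : SimpleInsertion (grid δ s t) (grid δ s t ∪ A)) (μ : PSpace p H) :
    W (run Θ A μ) (run Θ (grid δ s t) μ) ≤
      2 * M * (1 + μ.norm) * ((t - s) ^ (1 / 2 : ℝ) : ℝ≥0) *
        ((1 + dyadicSum β * 2 ^ β) * h ^ β + δ ^ β : ℝ≥0) := by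
  obtain ⟨n, hn, hn'⟩ := exists_nat_pow_near ((one_le_div₀ hδ).2 hδh)
    (one_lt_two : (1 : ℝ≥0) < 2)
  rw [le_div_iff₀ hδ] at hn
  rw [div_lt_iff₀ hδ] at hn'
  set η := 2 ^ (n + 1) * δ with hη
  have hη0 : 0 < η := by positivity
  have η_le : η ≤ 2 * h := by
    rw [hη, pow_succ', mul_assoc]
    gcongr
  have hG := isPart_grid hδ hA.le
  have insert_coarse := hE.W_run_le_of_simpleInsertion hA (hA.union (isPart_grid hη0 hA.le))
    (hfine.simpleInsertion_union_grid hA hη0 hn'.le) hfine hT μ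
  have halvings := hE.W_run_union_grid_le hp hβ hA hT hδ μ (n + 1)
  have delete_A := hE.W_run_le_of_simpleInsertion hG (hG.union hA) hins (isFine_grid hδ) hT μ
  rw [W_comm, Finset.union_comm] at delete_A
  refine (W_triangle hp _ (run Θ (A ∪ grid η s t) μ) _).trans ((add_le_add insert_coarse
    ((W_triangle hp _ (run Θ (A ∪ grid δ s t) μ) _).trans (add_le_add halvings delete_A))).trans ?_)
  rw [← mul_add, ← mul_add, ← ENNReal.coe_add, ← ENNReal.coe_add]
  refine mul_le_mul_right (ENNReal.coe_le_coe.2 ?_) _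
  calc h ^ β + (dyadicSum β * η ^ β + δ ^ β)
      ≤ h ^ β + (dyadicSum β * (2 * h) ^ β + δ ^ β) := by gcongr
    _ = (1 + dyadicSum β * 2 ^ β) * h ^ β + δ ^ β := by rw [NNReal.mul_rpow]; ring

end IsStable

end GridEstimate

section Dyadic

/-- The mesh `2^{-n}` of the dyadic grid of level `n`. -/
noncomputable def dyad (n : ℕ) : ℝ≥0 := (2 ^ n)⁻¹

/-- The largest point of the dyadic grid of level `n` that is at most `s`. -/
noncomputable def dyadFloor (n : ℕ) (s : ℝ≥0) : ℝ≥0 := ⌊2 ^ n * s⌋₊ * dyad n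

variable {E : Type*} {Θ : ℝ≥0 → ℝ≥0 → E → E} {n : ℕ} {s r t : ℝ≥0}

lemma dyad_pos (n : ℕ) : 0 < dyad n := by
  unfold dyad
  positivity

lemma dyad_eq_two_mul (n : ℕ) : dyad n = 2 * dyad (n + 1) := by
  unfold dyad
  rw [pow_succ]
  field_simp

lemma dyad_rpow (n : ℕ) (β : ℝ) : dyad n ^ β = (2 ^ β)⁻¹ ^ n := by
  rw [dyad, NNReal.inv_rpow, inv_pow, ← NNReal.rpow_natCast, ← NNReal.rpow_natCast,
    ← NNReal.rpow_mul, ← NNReal.rpow_mul, mul_comm]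

lemma tendsto_dyad : Tendsto dyad atTop (𝓝[>] 0) := by
  refine tendsto_nhdsWithin_iff.2 ⟨?_, Eventually.of_forall dyad_pos⟩
  have tendsto_pow := tendsto_pow_atTop_nhds_zero_of_lt_one (zero_le (a := (2⁻¹ : ℝ≥0)))
    (inv_lt_one_of_one_lt₀ one_lt_two)
  simp only [inv_pow] at tendsto_pow
  exact tendsto_pow

lemma tendsto_dyad_rpow {β : ℝ} (hβ : 0 < β) : Tendsto (fun n => dyad n ^ β) atTop (𝓝 0) := by
  simp only [dyad_rpow]
  exact tendsto_pow_atTop_nhds_zero_of_lt_one zero_le (two_rpow_inv_lt_one hβ)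

lemma dyadFloor_le (n : ℕ) (s : ℝ≥0) : dyadFloor n s ≤ s := by
  rw [dyadFloor, dyad, ← div_eq_mul_inv, div_le_iff₀' (by positivity)]
  exact Nat.floor_le zero_le

lemma le_dyadFloor_add (n : ℕ) (s : ℝ≥0) : s ≤ dyadFloor n s + dyad n := by
  rw [dyadFloor, dyad, ← div_eq_mul_inv, ← one_div, ← add_div, le_div_iff₀' (by positivity)]
  exact (Nat.lt_floor_add_one _).le

lemma mul_dyad_le_dyadFloor_iff {k : ℕ} : k * dyad n ≤ dyadFloor n s ↔ k * dyad n ≤ s := by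
  refine ⟨fun h => h.trans (dyadFloor_le n s), fun h => ?_⟩
  unfold dyadFloor
  gcongr
  refine Nat.le_floor ?_
  rwa [dyad, ← div_eq_mul_inv, div_le_iff₀' (by positivity)] at h

lemma dyadFloor_mono (h : s ≤ t) : dyadFloor n s ≤ dyadFloor n t :=
  mul_dyad_le_dyadFloor_iff.2 ((dyadFloor_le n s).trans h)

lemma floor_two_pow_mul_mono (h : s ≤ t) : ⌊2 ^ n * s⌋₊ ≤ ⌊2 ^ n * t⌋₊ :=
  Nat.floor_mono (by gcongr)

lemma image_range_eq_grid (hst : s ≤ t) :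
    (Finset.range (⌊2 ^ n * t⌋₊ - ⌊2 ^ n * s⌋₊ + 1)).image
      (fun k : ℕ => ((⌊2 ^ n * s⌋₊ + k : ℕ) : ℝ≥0) * dyad n) =
    grid (dyad n) (dyadFloor n s) (dyadFloor n t) := by
  have hab := floor_two_pow_mul_mono (n := n) hst
  ext x
  rw [mem_grid (dyad_pos n), Finset.mem_image]
  unfold dyadFloor
  constructor
  · rintro ⟨k, hk, rfl⟩
    have hk := Finset.mem_range_succ_iff.1 hk
    refine Or.inr (Or.inr ⟨_, rfl, ?_, ?_⟩) <;> gcongr <;> lia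
  · rintro (rfl | rfl | ⟨k, rfl, hsk, hkt⟩)
    · exact ⟨0, Finset.mem_range.2 (Nat.succ_pos _), by rw [add_zero]⟩
    · exact ⟨_, Finset.self_mem_range_succ _, by rw [Nat.add_sub_cancel' hab]⟩
    · have hsk := Nat.cast_le.1 (le_of_mul_le_mul_right hsk (dyad_pos n))
      have hkt := Nat.cast_le.1 (le_of_mul_le_mul_right hkt (dyad_pos n))
      exact ⟨k - ⌊2 ^ n * s⌋₊, Finset.mem_range_succ_iff.2 (by lia),
        by rw [Nat.add_sub_cancel' hsk]⟩

lemma dyadicScheme_eq_run (hΘ : ∀ t, Θ t t = id) (n : ℕ) (hst : s ≤ t) (μ : E) :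
    dyadicScheme Θ n s t μ = run Θ (grid (dyad n) (dyadFloor n s) (dyadFloor n t)) μ := by
  rw [dyadicScheme, compose_eq_run hΘ, ← image_range_eq_grid hst]
  · rfl
  · intro i _
    gcongr
    exact i.le_succ

lemma compose_add (τ : ℕ → ℝ≥0) (M N : ℕ) (μ : E) :
    compose Θ τ (M + N) μ = compose Θ (fun k => τ (M + k)) N (compose Θ τ M μ) := by
  induction N with
  | zero => rfl
  | succ N ih => rw [← add_assoc, compose, compose, ih, add_assoc]

lemma dyadicScheme_comp (n : ℕ) (hsr : s ≤ r) (hrt : r ≤ t) (μ : E) :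
    dyadicScheme Θ n s t μ = dyadicScheme Θ n r t (dyadicScheme Θ n s r μ) := by
  have hab := floor_two_pow_mul_mono (n := n) hsr
  have hbc := floor_two_pow_mul_mono (n := n) hrt
  unfold dyadicScheme
  rw [← Nat.sub_add_sub_cancel hbc hab, add_comm, compose_add]
  simp only [← add_assoc, Nat.add_sub_cancel' hab]

end Dyadic

section Rounding

lemma SimpleInsertion.refl (A : Finset ℝ≥0) : SimpleInsertion A A :=
  ⟨Finset.Subset.rfl, fun _ hx hxA => absurd hx hxA⟩

lemma simpleInsertion_insert (r : ℝ≥0) (A : Finset ℝ≥0) : SimpleInsertion A (insert r A) := by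
  refine ⟨Finset.subset_insert _ _, fun x hx hxA y hy hyA hxy => absurd hxy ?_⟩
  rw [(Finset.mem_insert.1 hx).resolve_right hxA, (Finset.mem_insert.1 hy).resolve_right hyA]
  exact lt_irrefl r

lemma insert_insert_grid_dyadFloor (n : ℕ) {s t : ℝ≥0} (hst : s ≤ t) :
    insert s (insert t (grid (dyad n) (dyadFloor n s) (dyadFloor n t))) =
      {dyadFloor n s, s} ∪ grid (dyad n) s t := by
  have hst' : dyadFloor n s ≤ dyadFloor n t := dyadFloor_mono hst
  have key : ∀ k : ℕ, (dyadFloor n s ≤ k * dyad n ∧ k * dyad n ≤ dyadFloor n t) ↔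
      k * dyad n = dyadFloor n s ∨ s ≤ k * dyad n ∧ k * dyad n ≤ t := by
    intro k
    rw [mul_dyad_le_dyadFloor_iff]
    constructor
    · rintro ⟨hsk, hkt⟩
      rcases le_total s (k * dyad n) with h | h
      exacts [Or.inr ⟨h, hkt⟩, Or.inl (le_antisymm (mul_dyad_le_dyadFloor_iff.2 h) hsk)]
    · rintro (h | h)
      exacts [⟨h.ge, h.trans_le ((dyadFloor_le n s).trans hst)⟩,
        ⟨(dyadFloor_le n s).trans h.1, h.2⟩]
  ext x
  simp only [Finset.mem_insert, Finset.mem_union, Finset.mem_singleton, mem_grid (dyad_pos n)]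
  constructor
  · rintro (rfl | rfl | rfl | rfl | ⟨k, rfl, hk⟩)
    · simp
    · simp
    · simp
    · rcases (key _).1 ⟨hst', le_rfl⟩ with h | h
      exacts [Or.inl (Or.inl h), Or.inr (Or.inr (Or.inr ⟨_, rfl, h⟩))]
    · rcases (key k).1 hk with h | h
      exacts [Or.inl (Or.inl h), Or.inr (Or.inr (Or.inr ⟨k, rfl, h⟩))]
  · rintro ((rfl | rfl) | rfl | rfl | ⟨k, rfl, hk⟩)
    · simp
    · simp
    · simp
    · simp
    · exact Or.inr (Or.inr (Or.inr (Or.inr ⟨k, rfl, (key k).2 (Or.inr hk)⟩)))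

variable {p : ℝ≥0} {H : Type*} [NormedAddCommGroup H] [MeasurableSpace H]
  {Θ : ℝ≥0 → ℝ≥0 → PSpace p H → PSpace p H} {β : ℝ} {T M s r t h δ : ℝ≥0} {A : Finset ℝ≥0}
  {φ : ℝ≥0 → ℝ≥0}

namespace IsStable

lemma one_add_norm_dyadicScheme_le (hE : IsStable Θ β T M) (hΘ : ∀ t, Θ t t = id)
    (hst : s ≤ t) (hT : t ≤ T) (n : ℕ) (μ : PSpace p H) :
    1 + (dyadicScheme Θ n s t μ).norm ≤ M * (1 + μ.norm) := by
  rw [dyadicScheme_eq_run hΘ n hst]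
  exact hE.norm_run_le (isPart_grid (dyad_pos n) (dyadFloor_mono hst))
    ((dyadFloor_le n t).trans hT) μ

lemma W_run_run_le (hE : IsStable Θ β T M) (hA : IsPart s t A) (hfine : IsFine h s t A)
    (hT : t ≤ T) (μ ν : PSpace p H) :
    W (run Θ A μ) (run Θ A ν) ≤
      M * (W μ ν + (1 + (μ.norm + ν.norm)) * (T ^ (1 / 2 : ℝ) * h ^ β : ℝ≥0)) := by
  refine (hE.W_run_le hA hA (.refl A) hfine hT μ ν).trans ?_
  gcongr
  exact tsub_le_self.trans hT

end IsStable

variable [BorelSpace H] [SecondCountableTopology H]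

lemma W_step_le (hφ : Monotone φ)
    (hC : ∀ s t : ℝ≥0, s < t → ∀ μ : PSpace p H, W (Θ s t μ) μ ≤ (1 + μ.norm) * φ (t - s))
    (hΘ : ∀ t, Θ t t = id) (hst : s ≤ t) (hδ : t ≤ s + δ) (μ : PSpace p H) :
    W (Θ s t μ) μ ≤ (1 + μ.norm) * φ δ := by
  rcases hst.eq_or_lt with rfl | hlt
  · rw [hΘ, id, W_self]
    exact zero_le
  · refine (hC s t hlt μ).trans ?_
    gcongr
    exact hφ (tsub_le_iff_left.2 hδ)

namespace IsStable

lemma W_run_insert_right_le (hE : IsStable Θ β T M) (hφ : Monotone φ)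
    (hC : ∀ s t : ℝ≥0, s < t → ∀ μ : PSpace p H, W (Θ s t μ) μ ≤ (1 + μ.norm) * φ (t - s))
    (hΘ : ∀ t, Θ t t = id) (hA : IsPart s r A) (hrt : r ≤ t) (hδ : t ≤ r + δ) (hT : t ≤ T)
    (μ : PSpace p H) :
    W (run Θ A μ) (run Θ (insert t A) μ) ≤ M * (1 + μ.norm) * φ δ := by
  rw [W_comm, run_insert_of_le hΘ hA hrt]
  refine (W_step_le hφ hC hΘ hrt hδ _).trans ?_
  gcongr
  exact hE.norm_run_le hA (hrt.trans hT) μ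

lemma W_run_pair_union_le (hE : IsStable Θ β T M) (hφ : Monotone φ)
    (hC : ∀ s t : ℝ≥0, s < t → ∀ μ : PSpace p H, W (Θ s t μ) μ ≤ (1 + μ.norm) * φ (t - s))
    (hΘ : ∀ t, Θ t t = id) (hrs : r ≤ s) (hδ : s ≤ r + δ) (hA : IsPart s t A)
    (hfine : IsFine δ s t A) (hT : t ≤ T) (μ : PSpace p H) :
    W (run Θ ({r, s} ∪ A) μ) (run Θ A μ) ≤
      M * ((1 + μ.norm) * φ δ + (M + 1) * (1 + μ.norm) * (T ^ (1 / 2 : ℝ) * δ ^ β : ℝ≥0)) := by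
  have norm_step_le := hE.norm_run_le (.pair hrs) (hA.le.trans hT) μ
  rw [run_union (.pair hrs) hA]
  rw [run_pair hΘ hrs] at norm_step_le ⊢
  have norm_add_le : 1 + ((Θ r s μ).norm + μ.norm) ≤ (M + 1) * (1 + μ.norm) := by
    rw [← add_assoc, add_mul, one_mul]
    exact add_le_add norm_step_le le_add_self
  refine (hE.W_run_run_le hA hfine hT _ _).trans ?_
  gcongr
  exact W_step_le hφ hC hΘ hrs hδ μ

variable [CompleteSpace H]

lemma W_dyadicScheme_run_le (hE : IsStable Θ β T M) (hp : 1 ≤ p) (hφ : Monotone φ)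
    (hC : ∀ s t : ℝ≥0, s < t → ∀ μ : PSpace p H, W (Θ s t μ) μ ≤ (1 + μ.norm) * φ (t - s))
    (hΘ : ∀ t, Θ t t = id) (hst : s ≤ t) (hT : t ≤ T) (n : ℕ) (μ : PSpace p H) :
    W (dyadicScheme Θ n s t μ) (run Θ (grid (dyad n) s t) μ) ≤
      M * (1 + μ.norm) * (M + 3) * (φ (dyad n) + T ^ (1 / 2 : ℝ) * dyad n ^ β : ℝ≥0) := by
  have hGp := isPart_grid (dyad_pos n) hst
  have hQp := isPart_grid (dyad_pos n) (dyadFloor_mono (n := n) hst)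
  have hQ := isFine_grid (dyad_pos n) (s := dyadFloor n s) (t := dyadFloor n t)
  rw [dyadicScheme_eq_run hΘ n hst]
  set G := grid (dyad n) s t
  set Q := grid (dyad n) (dyadFloor n s) (dyadFloor n t)
  have insert_t := hE.W_run_insert_right_le hφ hC hΘ hQp (dyadFloor_le n t)
    (le_dyadFloor_add n t) hT μ
  have insert_s : W (run Θ (insert t Q) μ) (run Θ ({dyadFloor n s, s} ∪ G) μ) ≤
      2 * M * (1 + μ.norm) * (T ^ (1 / 2 : ℝ) : ℝ≥0) * (dyad n ^ β : ℝ≥0) := by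
    refine (hE.W_run_le_of_simpleInsertion (hQp.insert_right (dyadFloor_le n t))
      ((IsPart.pair (dyadFloor_le n s)).append hGp) ?_
      (hQ.insert_right (le_dyadFloor_add n t)) hT μ).trans ?_
    · rw [← insert_insert_grid_dyadFloor n hst]
      exact simpleInsertion_insert s _
    · gcongr
      exact tsub_le_self.trans hT
  have delete_dyadFloor := hE.W_run_pair_union_le hφ hC hΘ (dyadFloor_le n s)
    (le_dyadFloor_add n s) hGp (isFine_grid (dyad_pos n)) hT μ
  have two_le : (2 : ℝ≥0∞) ≤ M + 3 := le_add_left (by norm_num)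
  refine (W_triangle hp _ (run Θ (insert t Q) μ) _).trans ((add_le_add insert_t
    ((W_triangle hp _ (run Θ ({dyadFloor n s, s} ∪ G) μ) _).trans
      (add_le_add insert_s delete_dyadFloor))).trans ?_)
  rw [ENNReal.coe_add, ENNReal.coe_mul]
  calc _ = M * (1 + μ.norm) * (2 * φ (dyad n) + (M + 3) *
        ((T ^ (1 / 2 : ℝ) : ℝ≥0) * (dyad n ^ β : ℝ≥0))) := by ring
    _ ≤ M * (1 + μ.norm) * ((M + 3) * φ (dyad n) + (M + 3) *
        ((T ^ (1 / 2 : ℝ) : ℝ≥0) * (dyad n ^ β : ℝ≥0))) := by gcongr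
    _ = _ := by ring

end IsStable

end Rounding

section LimitFlow

lemma tendsto_iff_of_edist {α ι : Type*} [PseudoEMetricSpace α] {l : Filter ι} {f g : ι → α}
    {a : α} (h : Tendsto (fun i => edist (f i) (g i)) l (𝓝 0)) :
    Tendsto f l (𝓝 a) ↔ Tendsto g l (𝓝 a) := by
  have tendsto_of : ∀ {f g : ι → α}, Tendsto (fun i => edist (f i) (g i)) l (𝓝 0) →
      Tendsto f l (𝓝 a) → Tendsto g l (𝓝 a) := by
    intro f g h hf
    rw [tendsto_iff_edist_tendsto_0] at hf ⊢
    have tendsto_add := h.add hf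
    rw [add_zero] at tendsto_add
    refine tendsto_of_tendsto_of_tendsto_of_le_of_le tendsto_const_nhds tendsto_add
      (fun _ => zero_le) fun i => ?_
    exact (edist_triangle _ (f i) _).trans_eq (congrArg (· + _) (edist_comm _ _))
  exact ⟨tendsto_of h, tendsto_of (by simpa only [edist_comm] using h)⟩

variable {p : ℝ≥0} [Fact (1 ≤ p)] {H : Type*} [NormedAddCommGroup H] [MeasurableSpace H]
  [BorelSpace H] [SecondCountableTopology H] [CompleteSpace H]
  {Θ : ℝ≥0 → ℝ≥0 → PSpace p H → PSpace p H} {β : ℝ} {T M s t h : ℝ≥0} {A : Finset ℝ≥0}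
  {μ ν : PSpace p H}

lemma tendsto_W_iff {ι : Type*} {l : Filter ι} {f : ι → PSpace p H} :
    Tendsto (fun i => W (f i) μ) l (𝓝 0) ↔ Tendsto f l (𝓝 μ) := by
  simp only [tendsto_iff_edist_tendsto_0, edist_eq_W]

namespace IsStable

lemma tendsto_dyadicScheme_iff (hE : IsStable Θ β T M) (hβ : 0 < β) (hC : ContinuityProperty Θ)
    (hΘ : ∀ t, Θ t t = id) (hst : s ≤ t) (hT : t ≤ T) :
    Tendsto (fun n => dyadicScheme Θ n s t μ) atTop (𝓝 ν) ↔
      Tendsto (fun n => run Θ (grid (dyad n) s t) μ) atTop (𝓝 ν) := by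
  obtain ⟨φ, hφ, hφ0, hC⟩ := hC
  have tendsto_bound : Tendsto
      (fun n => φ (dyad n) + T ^ (1 / 2 : ℝ) * dyad n ^ β) atTop (𝓝 0) := by
    simpa using (hφ0.comp tendsto_dyad).add ((tendsto_dyad_rpow hβ).const_mul (T ^ (1 / 2 : ℝ)))
  have ne_top : M * (1 + μ.norm) * (M + 3) ≠ ∞ := by
    have := μ.norm_ne_top
    finiteness
  have tendsto_mul := ENNReal.Tendsto.const_mul (ENNReal.tendsto_coe.2 tendsto_bound)
    (Or.inr ne_top)
  rw [ENNReal.coe_zero, mul_zero] at tendsto_mul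
  exact tendsto_iff_of_edist (tendsto_of_tendsto_of_tendsto_of_le_of_le tendsto_const_nhds
    tendsto_mul (fun _ => zero_le)
    fun n => hE.W_dyadicScheme_run_le Fact.out hφ hC hΘ hst hT n μ)

lemma exists_tendsto_dyadicScheme (hE : IsStable Θ β T M) (hβ : 0 < β)
    (hC : ContinuityProperty Θ) (hΘ : ∀ t, Θ t t = id) (hst : s ≤ t) (hT : t ≤ T)
    (μ : PSpace p H) : ∃ ν, Tendsto (fun n => dyadicScheme Θ n s t μ) atTop (𝓝 ν) := by
  simp only [hE.tendsto_dyadicScheme_iff hβ hC hΘ hst hT]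
  have ratio_lt_one : (((2 ^ β)⁻¹ : ℝ≥0) : ℝ≥0∞) < 1 := by
    exact_mod_cast two_rpow_inv_lt_one hβ
  have ne_top : 2 * M * (1 + μ.norm) * ((t - s) ^ (1 / 2 : ℝ) : ℝ≥0) ≠ ∞ := by
    have := μ.norm_ne_top
    finiteness
  refine cauchySeq_tendsto_of_complete
    (cauchySeq_of_edist_le_geometric _ _ ratio_lt_one ne_top fun n => ?_)
  have hins := simpleInsertion_grid_two_mul (dyad_pos (n + 1)) hst
  rw [← dyad_eq_two_mul] at hins
  rw [← ENNReal.coe_pow, ← dyad_rpow]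
  exact hE.W_run_le_of_simpleInsertion (isPart_grid (dyad_pos n) hst)
    (isPart_grid (dyad_pos (n + 1)) hst) hins (isFine_grid (dyad_pos n)) hT μ

lemma tendsto_dyadicScheme_comp (hE : IsStable Θ β T M) (hβ : 0 < β) (hΘ : ∀ t, Θ t t = id)
    (hst : s ≤ t) (hT : t ≤ T) {m : ℕ → PSpace p H} {b : ℝ≥0∞} (hb : b ≠ ∞)
    (hmb : ∀ n, (m n).norm ≤ b) (hm : Tendsto m atTop (𝓝 μ)) :
    Tendsto (fun n => W (dyadicScheme Θ n s t (m n)) (dyadicScheme Θ n s t μ)) atTop (𝓝 0) := by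
  have W_le : ∀ n, W (dyadicScheme Θ n s t (m n)) (dyadicScheme Θ n s t μ) ≤
      M * (W (m n) μ + (1 + (b + μ.norm)) * (T ^ (1 / 2 : ℝ) * dyad n ^ β : ℝ≥0)) := by
    intro n
    rw [dyadicScheme_eq_run hΘ n hst, dyadicScheme_eq_run hΘ n hst]
    refine (hE.W_run_run_le (isPart_grid (dyad_pos n) (dyadFloor_mono hst))
      (isFine_grid (dyad_pos n)) ((dyadFloor_le n t).trans hT) _ _).trans ?_
    have := hmb n
    gcongr
  have ne_top : 1 + (b + μ.norm) ≠ ∞ := by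
    have := μ.norm_ne_top
    finiteness
  have tendsto_rpow : Tendsto (fun n => T ^ (1 / 2 : ℝ) * dyad n ^ β) atTop (𝓝 0) := by
    simpa using (tendsto_dyad_rpow hβ).const_mul (T ^ (1 / 2 : ℝ))
  have tendsto_bound := ENNReal.Tendsto.const_mul (a := (M : ℝ≥0∞)) ((tendsto_W_iff.2 hm).add
    (ENNReal.Tendsto.const_mul (ENNReal.tendsto_coe.2 tendsto_rpow) (Or.inr ne_top)))
    (Or.inr ENNReal.coe_ne_top)
  rw [ENNReal.coe_zero, mul_zero, add_zero, mul_zero] at tendsto_bound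
  exact tendsto_of_tendsto_of_tendsto_of_le_of_le tendsto_const_nhds tendsto_bound
    (fun _ => zero_le) W_le

lemma W_run_limit_le (hE : IsStable Θ β T M) (hβ : 0 < β) (hC : ContinuityProperty Θ)
    (hΘ : ∀ t, Θ t t = id) (hT : t ≤ T) (hA : IsPart s t A) (hfine : IsFine h s t A)
    (hh : 0 < h) (hν : Tendsto (fun n => dyadicScheme Θ n s t μ) atTop (𝓝 ν)) :
    W (run Θ A μ) ν ≤ (2 * M * (1 + dyadicSum β * 2 ^ β) : ℝ≥0) * (1 + μ.norm) *
      ((t - s) ^ (1 / 2 : ℝ) : ℝ≥0) * (h ^ β : ℝ≥0) := by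
  have ne_top : 2 * M * (1 + μ.norm) * ((t - s) ^ (1 / 2 : ℝ) : ℝ≥0) ≠ ∞ := by
    have := μ.norm_ne_top
    finiteness
  rw [hE.tendsto_dyadicScheme_iff hβ hC hΘ hA.le hT] at hν
  have tendsto_bound := ENNReal.Tendsto.const_mul (ENNReal.tendsto_coe.2
    ((tendsto_dyad_rpow hβ).const_add ((1 + dyadicSum β * 2 ^ β) * h ^ β))) (Or.inr ne_top)
  rw [← edist_eq_W]
  refine (le_of_tendsto_of_tendsto (tendsto_const_nhds.edist hν) tendsto_bound ?_).trans_eq ?_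
  · filter_upwards [tendsto_dyad.eventually (eventually_simpleInsertion_grid_union hA),
      (tendsto_dyad.mono_right nhdsWithin_le_nhds).eventually_le_const hh] with n hins hn
    exact hE.W_run_grid_le Fact.out hβ hA hT hfine (dyad_pos n) hn hins μ
  · push_cast
    ring

end IsStable

theorem exists_isLimitFlow (hE : ∀ T, ∃ M, IsStable Θ β T M) (hβ : 0 < β)
    (hC : ContinuityProperty Θ) (hΘ : ∀ t, Θ t t = id) : ∃ θ, IsLimitFlow Θ θ := by
  have exists_limit : ∀ s t μ, ∃ ν, s ≤ t →
      Tendsto (fun n => dyadicScheme Θ n s t μ) atTop (𝓝 ν) := by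
    intro s t μ
    rcases le_or_gt s t with hst | hst
    · obtain ⟨M, hM⟩ := hE t
      obtain ⟨ν, hν⟩ := hM.exists_tendsto_dyadicScheme hβ hC hΘ hst le_rfl μ
      exact ⟨ν, fun _ => hν⟩
    · exact ⟨μ, fun h => absurd h hst.not_ge⟩
  choose θ hθ using exists_limit
  refine ⟨θ, fun s r t hsr hrt => funext fun μ => ?_,
    fun s t hst μ => tendsto_W_iff.2 (hθ s t μ hst.le)⟩
  obtain ⟨M, hM⟩ := hE t
  have ne_top : M * (1 + μ.norm) ≠ ∞ := by
    have := μ.norm_ne_top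
    finiteness
  have tendsto_comp := hM.tendsto_dyadicScheme_comp hβ hΘ hrt le_rfl ne_top
    (fun n => le_add_self.trans (hM.one_add_norm_dyadicScheme_le hΘ hsr hrt n μ)) (hθ s r μ hsr)
  simp only [← dyadicScheme_comp _ hsr hrt] at tendsto_comp
  exact tendsto_nhds_unique (hθ s t μ (hsr.trans hrt))
    ((tendsto_iff_of_edist tendsto_comp).2 (hθ r t _ hrt))

end LimitFlow

section Partitions

variable {s t : ℝ≥0} {p : ℝ≥0} [Fact (1 ≤ p)] {H : Type*} [NormedAddCommGroup H]
  [MeasurableSpace H] [BorelSpace H] [SecondCountableTopology H] [CompleteSpace H]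
  {Θ : ℝ≥0 → ℝ≥0 → PSpace p H → PSpace p H} {β : ℝ} {T M : ℝ≥0} {μ ν : PSpace p H}

namespace Partition

lemma exists_lt_le_add_mesh (π : Partition s t) {N : ℕ} (hN : N ≤ π.N) {x : ℝ≥0} (hs : s ≤ x)
    (hx : x < π.pt N) : ∃ i < π.N, x < π.pt (i + 1) ∧ π.pt (i + 1) ≤ x + π.mesh := by
  induction N with
  | zero => exact absurd hx (π.pt_zero.trans_le hs).not_gt
  | succ N ih =>
    rcases lt_or_ge x (π.pt N) with h | h
    · exact ih (N.le_succ.trans hN) h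
    · refine ⟨N, hN, hx, ?_⟩
      have le_mesh : π.pt (N + 1) - π.pt N ≤ π.mesh :=
        Finset.le_sup (f := fun i => π.pt (i + 1) - π.pt i) (Finset.mem_range.2 hN)
      exact (tsub_le_iff_left.1 le_mesh).trans (by gcongr)

lemma isFine (π : Partition s t) :
    IsFine π.mesh s t ((Finset.range (π.N + 1)).image π.pt) := by
  intro x hs ht
  obtain ⟨i, hi, hx⟩ := π.exists_lt_le_add_mesh le_rfl hs (ht.trans_eq π.pt_last.symm)
  exact ⟨_, Finset.mem_image_of_mem _ (Finset.mem_range.2 (Nat.succ_lt_succ hi)), hx⟩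

lemma isPart (π : Partition s t) : IsPart s t ((Finset.range (π.N + 1)).image π.pt) := by
  convert isPart_image fun i hi => (π.pt_lt i hi).le
  exacts [π.pt_zero.symm, π.pt_last.symm]

lemma mesh_pos (π : Partition s t) (hst : s < t) : 0 < π.mesh := by
  obtain ⟨y, -, hsy, hy⟩ := π.isFine s le_rfl hst
  exact pos_of_lt_add_right (hsy.trans_le hy)

/-- The partition of `[s, t]` without interior points. -/
def trivial (hst : s < t) : Partition s t where
  N := 1
  pt i := if i = 0 then s else t
  pt_zero := by simp
  pt_last := by simp
  pt_lt := by simp [hst]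

lemma mesh_trivial (hst : s < t) : (trivial hst).mesh = t - s := by
  simp [mesh, trivial]

lemma scheme_trivial {E : Type*} (Θ : ℝ≥0 → ℝ≥0 → E → E) (hst : s < t) (μ : E) :
    scheme Θ (trivial hst) μ = Θ s t μ := by
  simp [scheme, trivial, compose]

end Partition

lemma IsStable.W_scheme_le (hE : IsStable Θ β T M) (hβ : 0 < β) (hC : ContinuityProperty Θ)
    (hΘ : ∀ t, Θ t t = id) (hst : s < t) (hT : t ≤ T)
    (hν : Tendsto (fun n => W (dyadicScheme Θ n s t μ) ν) atTop (𝓝 0)) (π : Partition s t) :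
    W (scheme Θ π μ) ν ≤ (2 * M * (1 + dyadicSum β * 2 ^ β) : ℝ≥0) * (1 + μ.norm) *
      ((t - s) ^ (1 / 2 : ℝ) : ℝ≥0) * (π.mesh ^ β : ℝ≥0) := by
  rw [scheme, compose_eq_run hΘ fun i hi => (π.pt_lt i hi).le]
  exact hE.W_run_limit_le hβ hC hΘ hT π.isPart π.isFine (π.mesh_pos hst) (tendsto_W_iff.1 hν)

end Partitions

end WassersteinSewing

theorem theorem2p7 (p : ℝ≥0) (hp : 2 ≤ p) (β : ℝ) (hβ : 0 < β) (T : ℝ≥0) (hT : 0 < T)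
    (L C : ℝ≥0) (hL : 0 < L) (hC : 0 < C) :
    ∃ C' : ℝ≥0,
      ∀ (H : Type u) [NormedAddCommGroup H] [InnerProductSpace ℝ H] [CompleteSpace H]
        [TopologicalSpace.SeparableSpace H] [MeasurableSpace H] [BorelSpace H]
        (Ω : Type v) [mΩ : MeasurableSpace Ω] (P : Measure Ω) [IsProbabilityMeasure P]
        (ℱ : Filtration ℝ≥0 mΩ) (Θ : ℝ≥0 → ℝ≥0 → PSpace p H → PSpace p H),
        Atomless ℱ P → (∀ t : ℝ≥0, Θ t t = id) → SewingProperty ℱ P Θ β L C →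
        ContinuityProperty Θ →
        (∃ θ : ℝ≥0 → ℝ≥0 → PSpace p H → PSpace p H, IsLimitFlow Θ θ) ∧
        ∀ θ : ℝ≥0 → ℝ≥0 → PSpace p H → PSpace p H, IsLimitFlow Θ θ →
          ∀ s t : ℝ≥0, s < t → t ≤ T → ∀ μ : PSpace p H,
            (∀ π : Partition s t, W (scheme Θ π μ) (θ s t μ) ≤
              C' * (1 + μ.norm) * ((t - s) ^ (1 / 2 : ℝ) : ℝ≥0) * (π.mesh ^ β : ℝ≥0)) ∧
            W (Θ s t μ) (θ s t μ) ≤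
              C' * (1 + μ.norm) * ((t - s) ^ (1 / 2 + β) : ℝ≥0) := by
  refine ⟨2 * stabilityConst p T L C * (1 + dyadicSum β * 2 ^ β),
    fun H _ _ _ _ _ _ Ω _ P _ ℱ Θ hA hΘ ⟨𝒳, h𝒳⟩ hCP => ?_⟩
  have : Fact (1 ≤ p) := ⟨one_le_two.trans hp⟩
  have : SecondCountableTopology H := UniformSpace.secondCountable_of_separable H
  have hE := h𝒳.isStable hΘ hp hA hβ.le
  refine ⟨exists_isLimitFlow (fun T => ⟨_, hE T⟩) hβ hCP hΘ, fun θ hθ s t hst htT μ => ?_⟩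
  have W_scheme_le := (hE T).W_scheme_le hβ hCP hΘ hst htT (hθ.tendsto s t hst μ)
  refine ⟨W_scheme_le, ?_⟩
  have W_step_le := W_scheme_le (.trivial hst)
  rwa [Partition.scheme_trivial, Partition.mesh_trivial, mul_assoc, ← ENNReal.coe_mul,
    ← NNReal.rpow_add (tsub_pos_of_lt hst).ne'] at W_step_le
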